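/- **Model.** There are $K$ potential users, of which a set of exactly $K_a\ge 1$ is active. They share a codebook of $M\ge 1$ random codewords in $\mathbb C^n$, drawn i.i.d. either from $\mathcal{CN}(0,P'I_n)$ with $0<P'<P$ (Gaussian codebook) or uniformly from the sphere of radius $\sqrt{nP'}$ with $0<P'\le P$ (spherical codebook). Each active user $k$ picks a message $W_k$ uniformly from $\{1,\dots,M\}$ and sends the codeword $\mathbf c_{W_k}$ if $\|\mathbf c_{W_k}\|_2^2\le nP$, and $0$ otherwise; call the sent vector $\mathbf x_{W_k}$. The receiver has $L\ge 1$ antennas and observes $\mathbf Y=[\mathbf y_1,\dots,\mathbf y_L]\in\mathbb C^{n\times L}$ with $$\mathbf y_l=\sum_{k\text{ active}}h_{k,l}\,\mathbf x_{W_k}+\mathbf z_l,$$ where the $h_{k,l}$ are i.i.d. $\mathcal{CN}(0,1)$, the $\mathbf z_l$ are i.i.d. $\mathcal{CN}(0,I_n)$, and codebook, messages, fading and noise are independent. The number of active users is estimated by $$\arg\min_{0\le k\le K}\left|\frac{\|\mathbf Y\|_F^2}{nL}-(1+kP')\right|$$ (ties broken arbitrarily), and $\mathbb P[K_a\to K'_a]$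 denotes the probability that this estimate equals $K'_a$ when there are $K_a$ active users. **Claim.** Let $K,M,L,P,P'$, the active set and $K'_a\in\{1,\dots,K\}\setminus\{K_a\}$ be fixed. For both codebooks, the limit $\lim_{n\to\infty}\mathbb P[K_a\to K'_a]$ exists, is strictly positive (the estimation error does not vanish as $n$ grows), and satisfies $$\lim_{n\to\infty}\mathbb P[K_a\to K'_a]\le p_{K_a,K'_a}+\frac{\binom{K_a}{2}}{M},$$ where $$p_{K_a,K'_a}=\begin{cases}\exp\left\{K_aL\left(1-\frac{2K'_a+1}{2K_a}+\ln\frac{2K'_a+1}{2K_a}\right)\right\},&K'_a<K_a,\\[2mm]\exp\left\{K_aL\left(1-\frac{2K'_a-1}{2K_a}+\ln\frac{2K'_a-1}{2K_a}\right)\right\},&K'_a>K_a.\end{cases}$$ -/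

import Mathlib

open MeasureTheory ProbabilityTheory Filter Topology
open scoped NNReal ENNReal

namespace URA

noncomputable section

/-- The circularly symmetric complex Gaussian law `CN(0, v)` on `ℂ`: real and imaginary part
are independent real Gaussians with mean `0` and variance `v / 2`. -/
def complexGaussian (v : ℝ≥0) : Measure ℂ :=
  ((gaussianReal 0 (v / 2)).prod (gaussianReal 0 (v / 2))).map
    Complex.measurableEquivRealProd.symm

/-- The space `ℂⁿ` of codewords, with its Euclidean norm. -/
abbrev Codeword (n : ℕ) : Type := EuclideanSpace ℂ (Fin n)

/-- The law `CN(0, Q Iₙ)` of a Gaussian codeword of length `n` and power `Q`. -/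
def gaussianCodeword (Q : ℝ) (n : ℕ) : Measure (Codeword n) :=
  (Measure.pi fun _ : Fin n => complexGaussian Q.toNNReal).map (WithLp.toLp 2)

/-- The uniform law on the sphere of radius `√(n Q)` in `ℂⁿ`: the surface measure of the unit
sphere, normalized to total mass one, and scaled by `√(n Q)`. -/
def sphericalCodeword (Q : ℝ) (n : ℕ) : Measure (Codeword n) :=
  (((volume : Measure (Codeword n)).toSphere Set.univ)⁻¹ •
      (volume : Measure (Codeword n)).toSphere).map
    fun u : Metric.sphere (0 : Codeword n) 1 => √(n * Q) • (u : Codeword n)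

/-- The codeword that is actually sent in place of `c` under the maximal power constraint `P`:
`c` itself if `‖c‖² ≤ n P`, and `0` otherwise. -/
def transmitted {n : ℕ} (P : ℝ) (c : Codeword n) : Codeword n :=
  open scoped Classical in if ‖c‖ ^ 2 ≤ n * P then c else 0

/-- The received signal `Y ∈ ℂ^{n × L}`. Here `A` is the set of active users among the `K`
potential users, `c` is the common codebook, `W k` is the message of user `k`, `h k l` is the
fading coefficient between user `k` and antenna `l`, and `z` is the additive noise. -/
def received {K M L n : ℕ} (P : ℝ) (A : Finset (Fin K)) (c : Fin M → Codeword n)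
    (W : Fin K → Fin M) (h : Fin K → Fin L → ℂ) (z : Fin n → Fin L → ℂ) :
    Matrix (Fin n) (Fin L) ℂ :=
  Matrix.of fun i l => (∑ k ∈ A, h k l * transmitted P (c (W k)) i) + z i l

/-- The energy metric `m(Y, k) = | ‖Y‖_F² / (n L) - (1 + k Q) |`. -/
def energyMetric {n L : ℕ} (Q : ℝ) (Y : Matrix (Fin n) (Fin L) ℂ) (k : ℕ) : ℝ :=
  |(∑ i, ∑ l, ‖Y i l‖ ^ 2) / (n * L) - (1 + k * Q)|

/-- `est` is an energy-based estimator of the number of active users: `est Y` minimizes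
`m(Y, ·)` over `{0, …, K}` for every `Y`. Ties may be broken in any way. -/
def IsEnergyEstimator {n L : ℕ} (K : ℕ) (Q : ℝ) (est : Matrix (Fin n) (Fin L) ℂ → ℕ) : Prop :=
  ∀ Y, est Y ≤ K ∧ ∀ k ≤ K, energyMetric Q Y (est Y) ≤ energyMetric Q Y k

/-- The joint law of codebook, messages, fading coefficients and noise, all independent: the `M`
codewords are i.i.d. with law `codeLaw`, the messages are i.i.d. uniform on the `M` messages, and
the fading coefficients and the noise entries are i.i.d. `CN(0, 1)`. -/
def jointLaw {n : ℕ} (K M L : ℕ) (codeLaw : Measure (Codeword n)) :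
    Measure ((Fin M → Codeword n) × (Fin K → Fin M) ×
      (Fin K → Fin L → ℂ) × (Fin n → Fin L → ℂ)) :=
  (Measure.pi fun _ : Fin M => codeLaw).prod
    ((Measure.pi fun _ : Fin K => uniformOn (Set.univ : Set (Fin M))).prod
      ((Measure.pi fun _ : Fin K => Measure.pi fun _ : Fin L => complexGaussian 1).prod
        (Measure.pi fun _ : Fin n => Measure.pi fun _ : Fin L => complexGaussian 1)))

/-- `ℙ[Kₐ → K'ₐ]`: the probability that the estimator outputs `Kest` when `A` is the set of
active users. -/
def errorProb {n K L : ℕ} (M : ℕ) (P : ℝ) (A : Finset (Fin K)) (codeLaw : Measure (Codeword n))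
    (est : Matrix (Fin n) (Fin L) ℂ → ℕ) (Kest : ℕ) : ℝ :=
  (jointLaw K M L codeLaw).real
    {ω | est (received P A ω.1 ω.2.1 ω.2.2.1 ω.2.2.2) = Kest}

/-- The error floor for `Ka` active users, estimate `Kest ≠ Ka` and `L` antennas. -/
def errorFloor (Ka Kest L : ℕ) : ℝ :=
  if Kest < Ka then
    Real.exp (Ka * L * (1 - (2 * Kest + 1) / (2 * Ka) + Real.log ((2 * Kest + 1) / (2 * Ka))))
  else
    Real.exp (Ka * L * (1 - (2 * Kest - 1) / (2 * Ka) + Real.log ((2 * Kest - 1) / (2 * Ka))))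

end

end URA

namespace URA

/-! Grouping the active users by message, antenna `l` receives `∑ₘ a_{m,l} c_m + z_l`, where
`a_{m,l}` sums the fading coefficients of the users that chose `m`. For fixed `M` and `L` and large
`n`, with high probability every codeword meets the power constraint, and at each antenna the
codewords and the noise are almost orthogonal with normalized energies `Q` and `1`. Hence `‖Y‖² /
(nL)` is close to `1 + Q T`, where `T = (∑ |a_{m,l}|²) / L` (`fadingEnergy`) has a law that does not
depend on `n`. The estimator rounds to the nearest admissible integer, so the limit is the
probability that `T` lies in the cell of `Kest` (`tendsto_errorProb`). Ties do not matter because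
`T` has no atoms (`fadingLaw_fadingEnergy_eq`).

The limit is positive because `T` depends continuously on Gaussian coefficients of full support and
attains the value `Kest` (`measure_decisionRegion_pos`). For the upper bound, if the active users
chose distinct messages, `L T` is a sum of `Ka * L` independent unit exponentials, and Chernoff's
bound at the cell boundary facing `Ka` gives `errorFloor`. A union bound over pairs of users covers
the remaining case (`measureReal_decisionRegion_le`).

Only whiteness and energy concentration of the codeword law enter (`IsCodeFamily`), so one argument
serves both codebooks. -/

/-! ### Moments and null sets of the complex Gaussian law -/

lemma measurePreserving_complexGaussian (v : ℝ≥0) :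
    MeasurePreserving Complex.measurableEquivRealProd.symm
      ((gaussianReal 0 (v / 2)).prod (gaussianReal 0 (v / 2))) (complexGaussian v) :=
  ⟨Complex.measurableEquivRealProd.symm.measurable, rfl⟩

instance (v : ℝ≥0) : IsProbabilityMeasure (complexGaussian v) :=
  Measure.isProbabilityMeasure_map (by fun_prop)

lemma complexGaussian_absolutelyContinuous {v : ℝ≥0} (hv : v ≠ 0) :
    complexGaussian v ≪ (volume : Measure ℂ) := by
  rw [← Complex.volume_preserving_equiv_real_prod.symm.map_eq]
  have h := gaussianReal_absolutelyContinuous 0 (v := v / 2) (by simpa using hv)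
  exact (h.prod h).map Complex.measurableEquivRealProd.symm.measurable

lemma absolutelyContinuous_complexGaussian {v : ℝ≥0} (hv : v ≠ 0) :
    (volume : Measure ℂ) ≪ complexGaussian v := by
  rw [← Complex.volume_preserving_equiv_real_prod.symm.map_eq]
  have h := gaussianReal_absolutelyContinuous' 0 (v := v / 2) (by simpa using hv)
  exact (h.prod h).map Complex.measurableEquivRealProd.symm.measurable

lemma isOpenPosMeasure_complexGaussian {v : ℝ≥0} (hv : v ≠ 0) :
    (complexGaussian v).IsOpenPosMeasure :=
  (absolutelyContinuous_complexGaussian hv).isOpenPosMeasure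

lemma memLp_complexGaussian (v : ℝ≥0) {p : ℝ≥0∞} (hp : p ≠ ∞) :
    MemLp (fun z : ℂ => z) p (complexGaussian v) := by
  have hm := measurePreserving_complexGaussian v
  rw [← hm.map_eq, memLp_map_measure_iff (by fun_prop) hm.measurable.aemeasurable]
  have h := memLp_id_gaussianReal' (μ := 0) (v := v / 2) p hp
  have h1 : MemLp (fun x : ℝ × ℝ => ((x.1 : ℝ) : ℂ)) p
      ((gaussianReal 0 (v / 2)).prod (gaussianReal 0 (v / 2))) :=
    (h.comp_measurePreserving measurePreserving_fst).ofReal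
  have h2 : MemLp (fun x : ℝ × ℝ => Complex.I * ((x.2 : ℝ) : ℂ)) p
      ((gaussianReal 0 (v / 2)).prod (gaussianReal 0 (v / 2))) :=
    MemLp.const_mul (h.comp_measurePreserving measurePreserving_snd).ofReal _
  refine (h1.add h2).ae_eq (.of_forall fun x => ?_)
  apply Complex.ext <;> simp [Complex.measurableEquivRealProd]

lemma integral_complexGaussian_re (v : ℝ≥0) (f : ℝ → ℝ) :
    ∫ z, f z.re ∂complexGaussian v = ∫ x, f x ∂gaussianReal 0 (v / 2) := by
  have hm := measurePreserving_complexGaussian v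
  rw [← hm.integral_comp (MeasurableEquiv.measurableEmbedding _)]
  simpa [Complex.measurableEquivRealProd] using integral_fun_fst (μ := gaussianReal 0 (v / 2))
    (ν := gaussianReal 0 (v / 2)) f

lemma integral_complexGaussian_im (v : ℝ≥0) (f : ℝ → ℝ) :
    ∫ z, f z.im ∂complexGaussian v = ∫ x, f x ∂gaussianReal 0 (v / 2) := by
  have hm := measurePreserving_complexGaussian v
  rw [← hm.integral_comp (MeasurableEquiv.measurableEmbedding _)]
  simpa [Complex.measurableEquivRealProd] using integral_fun_snd (μ := gaussianReal 0 (v / 2))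
    (ν := gaussianReal 0 (v / 2)) f

lemma integral_id_complexGaussian (v : ℝ≥0) : ∫ z, z ∂complexGaussian v = 0 := by
  have hi : Integrable (fun z : ℂ => z) (complexGaussian v) :=
    memLp_one_iff_integrable.1 (memLp_complexGaussian v (p := 1) (by simp))
  have hre := integral_complexGaussian_re v (fun x => x)
  have him := integral_complexGaussian_im v (fun x => x)
  rw [integral_id_gaussianReal] at hre him
  apply Complex.ext
  · exact (integral_re hi).symm.trans hre
  · exact (integral_im hi).symm.trans him

lemma integrable_re_sq_complexGaussian (v : ℝ≥0) :
    Integrable (fun z : ℂ => z.re ^ 2) (complexGaussian v) :=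
  (memLp_complexGaussian v (p := 2) (by simp)).re.integrable_sq

lemma integrable_im_sq_complexGaussian (v : ℝ≥0) :
    Integrable (fun z : ℂ => z.im ^ 2) (complexGaussian v) :=
  (memLp_complexGaussian v (p := 2) (by simp)).im.integrable_sq

lemma integral_sq_gaussianReal (v : ℝ≥0) : ∫ x, x ^ 2 ∂gaussianReal 0 v = v := by
  have := variance_fun_id_gaussianReal (μ := 0) (v := v)
  rwa [variance_of_integral_eq_zero (by fun_prop) (by simp)] at this

lemma integral_norm_sq_complexGaussian (v : ℝ≥0) :
    ∫ z, ‖z‖ ^ 2 ∂complexGaussian v = v := by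
  have h : ∀ z : ℂ, ‖z‖ ^ 2 = z.re ^ 2 + z.im ^ 2 := fun z => by
    rw [← Complex.normSq_eq_norm_sq, Complex.normSq_apply]; ring
  simp_rw [h]
  rw [integral_add (integrable_re_sq_complexGaussian v) (integrable_im_sq_complexGaussian v),
    integral_complexGaussian_re v (fun x => x ^ 2), integral_complexGaussian_im v (fun x => x ^ 2),
    integral_sq_gaussianReal]
  push_cast
  ring

lemma memLp_norm_sq_complexGaussian (v : ℝ≥0) :
    MemLp (fun z : ℂ => ‖z‖ ^ 2) 2 (complexGaussian v) := by
  have h := (memLp_complexGaussian v (p := 4) (by simp)).norm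
  have h2 := h.mul' (r := 2) (p := 4) (hpqr := ⟨by
    rw [← two_mul, show (4 : ℝ≥0∞) = 2 * 2 by norm_num,
      ENNReal.mul_inv (by simp) (by simp), ← mul_assoc,
      ENNReal.mul_inv_cancel (by simp) (by simp), one_mul]⟩) h
  exact h2.ae_eq (.of_forall fun z => (sq _).symm)

/-- No restriction on `t` is needed: for `1 ≤ t` the integrand is not integrable and both sides take
the default value `0`. -/
lemma integral_exp_sq_gaussianReal (t : ℝ) :
    ∫ x, Real.exp (t * x ^ 2) ∂gaussianReal 0 (1 / 2) = (√(1 - t))⁻¹ := by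
  rw [integral_gaussianReal_eq_integral_smul (by simp)]
  have h : ∀ x : ℝ, gaussianPDFReal 0 (1 / 2) x • Real.exp (t * x ^ 2)
      = (√Real.pi)⁻¹ * Real.exp (-(1 - t) * x ^ 2) := fun x => by
    rw [gaussianPDFReal, smul_eq_mul, mul_assoc, ← Real.exp_add]
    push_cast
    congr 1
    · congr 2; ring
    · congr 1; ring
  simp_rw [h]
  rw [integral_const_mul, integral_gaussian, Real.sqrt_div Real.pi_pos.le]
  have := Real.sqrt_pos.2 Real.pi_pos
  field_simp

lemma integral_exp_norm_sq_complexGaussian {t : ℝ} (ht : t < 1) :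
    ∫ z, Real.exp (t * ‖z‖ ^ 2) ∂complexGaussian 1 = (1 - t)⁻¹ := by
  have hm := measurePreserving_complexGaussian 1
  rw [← hm.integral_comp (MeasurableEquiv.measurableEmbedding _)]
  have h : ∀ x : ℝ × ℝ, Real.exp (t * ‖Complex.measurableEquivRealProd.symm x‖ ^ 2)
      = Real.exp (t * x.1 ^ 2) * Real.exp (t * x.2 ^ 2) := fun x => by
    rw [← Complex.normSq_eq_norm_sq, Complex.normSq_apply, ← Real.exp_add]
    congr 1
    simp [Complex.measurableEquivRealProd]
    ring
  simp_rw [h]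
  rw [integral_prod_mul (fun x => Real.exp (t * x ^ 2)) (fun x => Real.exp (t * x ^ 2)),
    integral_exp_sq_gaussianReal, ← mul_inv, Real.mul_self_sqrt (by linarith)]

lemma complexGaussian_sphere {v : ℝ≥0} (hv : v ≠ 0) (a : ℂ) (s : ℝ) :
    complexGaussian v {z | ‖z + a‖ ^ 2 = s} = 0 := by
  apply complexGaussian_absolutelyContinuous hv
  refine measure_mono_null (t := Metric.sphere (-a) √s) (fun z hz => ?_)
    (Measure.addHaar_sphere volume _ _)
  rw [mem_sphere_iff_norm, sub_neg_eq_add, ← (hz : ‖z + a‖ ^ 2 = s), Real.sqrt_sq (norm_nonneg _)]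

/-! ### The limiting energy as a function of messages and fading -/

/-- The fading coefficient with which message `m` arrives at antenna `l`: the sum of the
coefficients of the active users that chose `m`. -/
noncomputable def aggregate {K M L : ℕ} (A : Finset (Fin K)) (W : Fin K → Fin M)
    (h : Fin K → Fin L → ℂ) (m : Fin M) (l : Fin L) : ℂ :=
  ∑ k ∈ A with W k = m, h k l

/-- The total energy of the aggregate fading coefficients, averaged over the antennas. -/
noncomputable def fadingEnergy {K M L : ℕ} (A : Finset (Fin K)) (W : Fin K → Fin M)
    (h : Fin K → Fin L → ℂ) : ℝ :=
  (∑ l, ∑ m, ‖aggregate A W h m l‖ ^ 2) / L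

/-- The joint law of the fading coefficients. -/
noncomputable abbrev fadingLaw (K L : ℕ) : Measure (Fin K → Fin L → ℂ) :=
  Measure.pi fun _ : Fin K => Measure.pi fun _ : Fin L => complexGaussian 1

/-- The joint law of the messages. -/
noncomputable abbrev messageLaw (K M : ℕ) : Measure (Fin K → Fin M) :=
  Measure.pi fun _ : Fin K => uniformOn (Set.univ : Set (Fin M))

/-- The normalized energies that are nearest to `Kest` among `0, …, K`, ties excluded. -/
def decisionRegion (K Kest : ℕ) : Set ℝ :=
  {u | (Kest : ℝ) - 1 / 2 < u ∧ (Kest < K → u < Kest + 1 / 2)}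

lemma isOpen_decisionRegion (K Kest : ℕ) : IsOpen (decisionRegion K Kest) := by
  by_cases h : Kest < K
  · simp only [decisionRegion, h, forall_const]
    exact isOpen_Ioo
  · simp only [decisionRegion, h, IsEmpty.forall_iff, and_true]
    exact isOpen_Ioi

lemma continuous_aggregate {K M L : ℕ} (A : Finset (Fin K)) (W : Fin K → Fin M) (m : Fin M)
    (l : Fin L) : Continuous fun h : Fin K → Fin L → ℂ => aggregate A W h m l := by
  unfold aggregate
  fun_prop

lemma continuous_fadingEnergy {K M L : ℕ} (A : Finset (Fin K)) (W : Fin K → Fin M) :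
    Continuous fun h : Fin K → Fin L → ℂ => fadingEnergy A W h := by
  have := fun m l => continuous_aggregate (L := L) A W m l
  unfold fadingEnergy
  fun_prop

lemma measurable_fadingEnergy {K M L : ℕ} (A : Finset (Fin K)) :
    Measurable fun x : (Fin K → Fin M) × (Fin K → Fin L → ℂ) => fadingEnergy A x.1 x.2 :=
  measurable_from_prod_countable_right fun W => (continuous_fadingEnergy A W).measurable

/-! ### Absence of atoms and positivity -/

/-- Fubini in a single coordinate: a set whose sections along coordinate `i` are all null is null.
-/
lemma pi_eq_zero_of_update {ι : Type*} [Fintype ι] [DecidableEq ι] {α : ι → Type*}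
    [∀ i, MeasurableSpace (α i)] (μ : ∀ i, Measure (α i)) [∀ i, SigmaFinite (μ i)]
    {B : Set (∀ i, α i)} (hB : MeasurableSet B) (i : ι)
    (h : ∀ x, μ i {y | Function.update x i y ∈ B} = 0) : Measure.pi μ B = 0 := by
  rw [← lintegral_indicator_one hB, ← lintegral_zero (μ := Measure.pi μ)]
  refine lintegral_eq_of_lmarginal_eq {i} (measurable_one.indicator hB) measurable_const ?_
  funext x
  rw [lmarginal_singleton, lmarginal_singleton]
  simp only [lintegral_zero]
  rw [← h x]
  exact lintegral_indicator_one (measurable_update x hB)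

/-- Isolates the dependence on one fading coefficient `z`: it enters a single aggregate, additively.
-/
lemma aggregate_update {K M L : ℕ} {A : Finset (Fin K)} (W : Fin K → Fin M)
    (h : Fin K → Fin L → ℂ) {k₀ : Fin K} (hk₀ : k₀ ∈ A) (y : Fin L → ℂ) (l₀ : Fin L) (z : ℂ)
    (m : Fin M) (l : Fin L) :
    aggregate A W (Function.update h k₀ (Function.update y l₀ z)) m l =
      (if m = W k₀ ∧ l = l₀ then z else 0) +
        aggregate A W (Function.update h k₀ (Function.update y l₀ 0)) m l := by
  have key : ∀ k, Function.update h k₀ (Function.update y l₀ z) k l =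
      (if k = k₀ then (if l = l₀ then z else 0) else 0) +
        Function.update h k₀ (Function.update y l₀ 0) k l := by
    intro k
    by_cases hk : k = k₀
    · subst hk
      by_cases hl : l = l₀
      · subst hl; simp
      · simp [hl]
    · simp [hk]
  simp only [aggregate, key, Finset.sum_add_distrib]
  congr 1
  rw [Finset.sum_ite_eq']
  simp only [Finset.mem_filter, hk₀, true_and, eq_comm (a := m), ite_and]

/-- With all coefficients but one frozen, the level set confines that one to a circle, possibly
degenerate or empty, which is Lebesgue null. -/
lemma fadingLaw_fadingEnergy_eq {K M L : ℕ} {A : Finset (Fin K)} (hA : A.Nonempty)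
    (hL : 1 ≤ L) (W : Fin K → Fin M) (t : ℝ) :
    fadingLaw K L {h | fadingEnergy A W h = t} = 0 := by
  obtain ⟨k₀, hk₀⟩ := hA
  let l₀ : Fin L := ⟨0, hL⟩
  have hm : MeasurableSet {h : Fin K → Fin L → ℂ | fadingEnergy A W h = t} :=
    (continuous_fadingEnergy A W).measurable (measurableSet_singleton t)
  -- The fading law is a product over users of products over antennas, so the coordinate is singled
  -- out in two stages.
  refine pi_eq_zero_of_update _ hm k₀ fun h => ?_
  have hm' := measurable_update (a := k₀) h hm
  refine pi_eq_zero_of_update _ hm' l₀ fun y => ?_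
  let B : Fin L → Fin M → ℂ := fun l m =>
    aggregate A W (Function.update h k₀ (Function.update y l₀ 0)) m l
  refine measure_mono_null (fun z hz => ?_) (complexGaussian_sphere one_ne_zero (B l₀ (W k₀))
    (t * L - ∑ p ∈ Finset.univ.erase (l₀, W k₀), ‖B p.1 p.2‖ ^ 2))
  have hz' : fadingEnergy A W (Function.update h k₀ (Function.update y l₀ z)) = t := hz
  have hL0 : (L : ℝ) ≠ 0 := by positivity
  rw [fadingEnergy, div_eq_iff hL0, ← Fintype.sum_prod_type',
    ← Finset.add_sum_erase _ _ (Finset.mem_univ (l₀, W k₀))] at hz'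
  rw [Set.mem_ofPred_eq, ← hz', eq_sub_iff_add_eq]
  congr 1
  · rw [aggregate_update W h hk₀ y l₀ z, if_pos ⟨rfl, rfl⟩]
  · refine Finset.sum_congr rfl fun p hp => ?_
    have hp' : ¬ (p.2 = W k₀ ∧ p.1 = l₀) := fun hh =>
      Finset.ne_of_mem_erase hp (Prod.ext hh.2 hh.1)
    rw [aggregate_update W h hk₀ y l₀ z, if_neg hp', zero_add]

lemma uniformOn_univ_singleton {M : ℕ} (m : Fin M) :
    uniformOn (Set.univ : Set (Fin M)) {m} = (M : ℝ≥0∞)⁻¹ := by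
  rw [uniformOn_univ]
  simp

lemma isProbabilityMeasure_uniformOn_fin {M : ℕ} (hM : 1 ≤ M) :
    IsProbabilityMeasure (uniformOn (Set.univ : Set (Fin M))) :=
  have : Nonempty (Fin M) := ⟨⟨0, hM⟩⟩
  isProbabilityMeasure_uniformOn Set.finite_univ Set.univ_nonempty

lemma messageLaw_prod_fadingLaw_fadingEnergy_eq {K M L : ℕ} {A : Finset (Fin K)}
    (hA : A.Nonempty) (hL : 1 ≤ L) (t : ℝ) :
    ((messageLaw K M).prod (fadingLaw K L)) {x | fadingEnergy A x.1 x.2 = t} = 0 := by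
  refine (Measure.measure_prod_null
    (measurable_fadingEnergy A (measurableSet_singleton t))).2 ?_
  exact .of_forall fun W => fadingLaw_fadingEnergy_eq hA hL W t

lemma measure_decisionRegion_pos {K M L : ℕ} (hM : 1 ≤ M) (hL : 1 ≤ L) {A : Finset (Fin K)}
    (hA : A.Nonempty) (Kest : ℕ) :
    0 < ((messageLaw K M).prod (fadingLaw K L))
      {x | fadingEnergy A x.1 x.2 ∈ decisionRegion K Kest} := by
  have := isProbabilityMeasure_uniformOn_fin hM
  have := isOpenPosMeasure_complexGaussian one_ne_zero
  obtain ⟨k₀, hk₀⟩ := hA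
  let W : Fin K → Fin M := fun _ => ⟨0, hM⟩
  let U : Set (Fin K → Fin L → ℂ) := {h | fadingEnergy A W h ∈ decisionRegion K Kest}
  have hU : IsOpen U := (isOpen_decisionRegion K Kest).preimage (continuous_fadingEnergy A W)
  have hne : U.Nonempty := by
    -- Only `k₀` has nonzero fading, equal to `√Kest` at every antenna, so the energy is exactly
    -- `Kest`.
    refine ⟨fun k _ => if k = k₀ then (√Kest : ℝ) else 0, ?_⟩
    have hagg : ∀ (m : Fin M) (l : Fin L), ‖aggregate A W
        (fun k _ => if k = k₀ then ((√Kest : ℝ) : ℂ) else 0) m l‖ ^ 2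
          = if m = W k₀ then (Kest : ℝ) else 0 := fun m l => by
      rw [aggregate, Finset.sum_ite_eq']
      by_cases hm : W k₀ = m
      · simp [hk₀, hm]
      · simp [hm, Ne.symm hm]
    have hL0 : (L : ℝ) ≠ 0 := by positivity
    have : fadingEnergy A W (fun k (_ : Fin L) => if k = k₀ then ((√Kest : ℝ) : ℂ) else 0)
        = Kest := by
      simp [fadingEnergy, hagg, hL0]
    rw [Set.mem_ofPred_eq, this]
    exact ⟨by linarith, fun _ => by linarith⟩
  calc 0 < messageLaw K M {W} * fadingLaw K L U := by
        refine ENNReal.mul_pos ?_ (hU.measure_pos _ hne).ne'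
        rw [Measure.pi_singleton]
        simp [uniformOn_univ_singleton, Finset.prod_const]
    _ = ((messageLaw K M).prod (fadingLaw K L)) ({W} ×ˢ U) := (Measure.prod_prod _ _).symm
    _ ≤ _ := measure_mono (by rintro ⟨W', h⟩ ⟨hW, hh⟩; obtain rfl : W' = W := hW; exact hh)

/-! ### Upper bound: Chernoff and message collisions -/

lemma fadingEnergy_of_injOn {K M L : ℕ} {A : Finset (Fin K)} {W : Fin K → Fin M}
    (hW : Set.InjOn W A) (h : Fin K → Fin L → ℂ) :
    fadingEnergy A W h = (∑ k ∈ A, ∑ l, ‖h k l‖ ^ 2) / L := by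
  rw [fadingEnergy, Finset.sum_comm (s := A)]
  congr 1
  refine Finset.sum_congr rfl fun l _ => ?_
  rw [← Finset.sum_fiberwise A W]
  refine Finset.sum_congr rfl fun m _ => ?_
  rw [aggregate]
  rcases (A.filter fun k => W k = m).eq_empty_or_nonempty with h0 | ⟨a, ha⟩
  · simp [h0]
  · have h1 : (A.filter fun k => W k = m) = {a} := by
      refine Finset.eq_singleton_iff_unique_mem.2 ⟨ha, fun b hb => ?_⟩
      simp only [Finset.mem_filter] at ha hb
      exact hW hb.1 ha.1 (hb.2.trans ha.2.symm)
    simp [h1]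

/-- Each `‖h k l‖ ^ 2` is a unit exponential with moment generating function `(1 - t)⁻¹`, and they
are independent. -/
lemma mgf_sum_norm_sq {K L : ℕ} (A : Finset (Fin K)) {t : ℝ} (ht : t < 1) :
    mgf (fun h : Fin K → Fin L → ℂ => ∑ k ∈ A, ∑ l, ‖h k l‖ ^ 2) (fadingLaw K L) t =
      ((1 - t)⁻¹) ^ (A.card * L) := by
  let g : Fin K → (Fin L → ℂ) → ℝ := fun k y =>
    if k ∈ A then ∏ l, Real.exp (t * ‖y l‖ ^ 2) else 1
  have h1 : ∀ h : Fin K → Fin L → ℂ, Real.exp (t * ∑ k ∈ A, ∑ l, ‖h k l‖ ^ 2) =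
      ∏ k, g k (h k) := fun h => by
    simp [g, Finset.mul_sum, Real.exp_sum]
  refine (integral_congr_ae (.of_forall h1)).trans ((integral_fintype_prod_eq_prod g).trans ?_)
  have h2 : ∀ k : Fin K, ∫ y : Fin L → ℂ, g k y
      ∂(Measure.pi fun _ : Fin L => complexGaussian 1) =
        if k ∈ A then ((1 - t)⁻¹) ^ L else 1 := fun k => by
    simp only [g]
    split_ifs
    · rw [integral_fintype_prod_eq_prod (fun _ z => Real.exp (t * ‖z‖ ^ 2))]
      simp [integral_exp_norm_sq_complexGaussian ht]
    · simp
  simp_rw [h2]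
  simp [← pow_mul, mul_comm]

lemma integrable_exp_sum_norm_sq {K L : ℕ} (A : Finset (Fin K)) {t : ℝ} (ht : t < 1) :
    Integrable (fun h : Fin K → Fin L → ℂ => Real.exp (t * ∑ k ∈ A, ∑ l, ‖h k l‖ ^ 2))
      (fadingLaw K L) := by
  -- The product formula for the integral holds unconditionally, and its value is nonzero; a
  -- nonintegrable function would have integral `0`.
  refine Integrable.of_integral_ne_zero ?_
  have := mgf_sum_norm_sq (L := L) A ht
  rw [mgf] at this
  rw [this]
  have : (1 - t)⁻¹ ≠ 0 := inv_ne_zero (by linarith)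
  positivity

/-- `1 - x⁻¹` is the tilt that optimizes Chernoff's bound for `N` unit exponentials at level `N *
x`; it is nonpositive for `x ≤ 1` and nonnegative for `1 ≤ x`. -/
lemma chernoff_exponent {x : ℝ} (hx : 0 < x) (N : ℕ) :
    Real.exp (-(1 - x⁻¹) * (N * x)) * ((1 - (1 - x⁻¹))⁻¹) ^ N =
      Real.exp (N * (1 - x + Real.log x)) := by
  rw [sub_sub_cancel, inv_inv, ← Real.exp_log hx, ← Real.exp_nat_mul, ← Real.exp_add,
    Real.exp_log hx]
  congr 1
  field_simp
  ring

lemma measureReal_sum_norm_sq_le {K L : ℕ} (A : Finset (Fin K)) {x : ℝ} (hx : 0 < x)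
    (hx1 : x ≤ 1) :
    (fadingLaw K L).real {h | ∑ k ∈ A, ∑ l, ‖h k l‖ ^ 2 ≤ A.card * L * x} ≤
      Real.exp (A.card * L * (1 - x + Real.log x)) := by
  have hlt : 1 - x⁻¹ < 1 := by simpa using hx
  have h := measure_le_le_exp_mul_mgf (A.card * L * x)
    (sub_nonpos.2 ((one_le_inv₀ hx).2 hx1)) (integrable_exp_sum_norm_sq (L := L) A hlt)
  rw [mgf_sum_norm_sq A hlt] at h
  have h2 := chernoff_exponent hx (A.card * L)
  push_cast at h2
  rwa [h2] at h

lemma measureReal_sum_norm_sq_ge {K L : ℕ} (A : Finset (Fin K)) {x : ℝ} (hx1 : 1 ≤ x) :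
    (fadingLaw K L).real {h | A.card * L * x ≤ ∑ k ∈ A, ∑ l, ‖h k l‖ ^ 2} ≤
      Real.exp (A.card * L * (1 - x + Real.log x)) := by
  have hx : 0 < x := by linarith
  have hlt : 1 - x⁻¹ < 1 := by simpa using hx
  have h := measure_ge_le_exp_mul_mgf (A.card * L * x)
    (sub_nonneg.2 (inv_le_one_of_one_le₀ hx1)) (integrable_exp_sum_norm_sq (L := L) A hlt)
  rw [mgf_sum_norm_sq A hlt] at h
  have h2 := chernoff_exponent hx (A.card * L)
  push_cast at h2
  rwa [h2] at h

/-- Sum over the `M` possible common values, each of probability `M⁻¹ * M⁻¹`. -/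
lemma messageLaw_eq_le {K M : ℕ} (hM : 1 ≤ M) {i j : Fin K} (hij : i ≠ j) :
    messageLaw K M {W | W i = W j} ≤ (M : ℝ≥0∞)⁻¹ := by
  have := isProbabilityMeasure_uniformOn_fin hM
  have hsub : {W : Fin K → Fin M | W i = W j} ⊆ ⋃ m : Fin M,
      (Set.univ.pi fun k => if k ∈ ({i, j} : Finset (Fin K)) then {m} else Set.univ) := by
    intro W hW
    refine Set.mem_iUnion.2 ⟨W i, fun k _ => ?_⟩
    rw [Set.mem_ofPred_eq] at hW
    simp only [Finset.mem_insert, Finset.mem_singleton]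
    split_ifs with h
    · rcases h with rfl | rfl
      · rfl
      · exact hW.symm
    · trivial
  refine (measure_mono hsub).trans ((measure_iUnion_fintype_le _ _).trans ?_)
  have hprod : ∀ m : Fin M, messageLaw K M
      (Set.univ.pi fun k => if k ∈ ({i, j} : Finset (Fin K)) then {m} else Set.univ)
        = (M : ℝ≥0∞)⁻¹ * (M : ℝ≥0∞)⁻¹ := fun m => by
    rw [Measure.pi_pi, ← Finset.prod_subset (Finset.subset_univ ({i, j} : Finset (Fin K)))]
    · rw [Finset.prod_pair hij]
      simp [uniformOn_univ_singleton]
    · intro k _ hk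
      rw [if_neg hk, measure_univ]
  simp_rw [hprod]
  rw [Finset.sum_const, Finset.card_univ, Fintype.card_fin, nsmul_eq_mul, ← mul_assoc,
    ENNReal.mul_inv_cancel (by simp; omega) (by simp), one_mul]

lemma messageLaw_not_injOn_le {K M : ℕ} (hM : 1 ≤ M) (A : Finset (Fin K)) :
    (messageLaw K M).real {W | ¬ Set.InjOn W A} ≤ (A.card.choose 2 : ℝ) / M := by
  have := isProbabilityMeasure_uniformOn_fin hM
  have hsub : {W : Fin K → Fin M | ¬ Set.InjOn W A} ⊆ ⋃ s ∈ A.powersetCard 2,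
      {W | ¬ Set.InjOn W (s : Set (Fin K))} := by
    intro W hW
    simp only [Set.mem_ofPred_eq, Set.InjOn, not_forall] at hW
    obtain ⟨i, hi, j, hj, hWij, hij⟩ := hW
    refine Set.mem_biUnion (x := {i, j}) ?_ fun hinj => hij ?_
    · simp only [Finset.mem_coe, Finset.mem_powersetCard, Finset.card_pair hij, and_true]
      simpa [Finset.insert_subset_iff] using ⟨hi, hj⟩
    · exact hinj (by simp) (by simp) hWij
  have hle : messageLaw K M {W | ¬ Set.InjOn W A} ≤ (A.card.choose 2 : ℝ≥0∞) / M := by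
    refine (measure_mono hsub).trans ((measure_biUnion_finset_le _ _).trans ?_)
    refine (Finset.sum_le_card_nsmul _ _ (M : ℝ≥0∞)⁻¹ fun s hs => ?_).trans_eq ?_
    · obtain ⟨i, j, hij, rfl⟩ := Finset.card_eq_two.1 (Finset.mem_powersetCard.1 hs).2
      refine (measure_mono fun W hW => ?_).trans (messageLaw_eq_le hM hij)
      by_contra hne
      refine hW ?_
      rw [Finset.coe_pair, Set.injOn_pair]
      exact fun hh => absurd hh hne
    · rw [Finset.card_powersetCard, nsmul_eq_mul, div_eq_mul_inv]
  refine (ENNReal.toReal_mono ?_ hle).trans_eq ?_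
  · exact ENNReal.div_ne_top (by simp) (by simp; omega)
  · simp

lemma measureReal_decisionRegion_le {K M L : ℕ} (hM : 1 ≤ M) (hL : 1 ≤ L) {A : Finset (Fin K)}
    (hA : 1 ≤ A.card) {Kest : ℕ} (hKest : Kest ≤ K) (hne : Kest ≠ A.card) :
    ((messageLaw K M).prod (fadingLaw K L)).real
        {x | fadingEnergy A x.1 x.2 ∈ decisionRegion K Kest} ≤
      errorFloor A.card Kest L + (A.card.choose 2 : ℝ) / M := by
  have := isProbabilityMeasure_uniformOn_fin hM
  let F : Set (Fin K → Fin L → ℂ) :=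
    {h | (∑ k ∈ A, ∑ l, ‖h k l‖ ^ 2) / L ∈ decisionRegion K Kest}
  have hsub : {x : (Fin K → Fin M) × (Fin K → Fin L → ℂ) |
      fadingEnergy A x.1 x.2 ∈ decisionRegion K Kest} ⊆
        Set.univ ×ˢ F ∪ {W | ¬ Set.InjOn W A} ×ˢ Set.univ := by
    rintro ⟨W, h⟩ hx
    by_cases hW : Set.InjOn W A
    · exact .inl ⟨trivial, by simpa [F, ← fadingEnergy_of_injOn hW] using hx⟩
    · exact .inr ⟨hW, trivial⟩
  refine (measureReal_mono hsub).trans ((measureReal_union_le _ _).trans ?_)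
  rw [measureReal_prod_prod, measureReal_prod_prod, probReal_univ, probReal_univ, one_mul, mul_one]
  refine add_le_add ?_ (messageLaw_not_injOn_le hM A)
  have hKL : A.card ≤ K := by simpa using Finset.card_le_univ A
  have hL0 : (0 : ℝ) < L := by positivity
  have hA0 : (0 : ℝ) < A.card := by positivity
  have hcast : ∀ a : ℝ, A.card * L * ((2 * a) / (2 * A.card)) = a * L := fun a => by
    field_simp
  rw [errorFloor]
  split_ifs with hlt
  · have hc : (Kest : ℝ) + 1 ≤ A.card := by exact_mod_cast hlt
    refine le_trans (measureReal_mono fun h hh => ?_) (measureReal_sum_norm_sq_le A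
      (x := (2 * Kest + 1) / (2 * A.card)) (by positivity) ?_)
    -- Since `Kest < A.card ≤ K`, the cell has the upper boundary `Kest + 1 / 2`.
    · have h2 := (hh.2 (by omega)).le
      rw [div_le_iff₀ hL0] at h2
      have := hcast (Kest + 1 / 2)
      rw [show 2 * ((Kest : ℝ) + 1 / 2) = 2 * Kest + 1 by ring] at this
      rwa [Set.mem_ofPred_eq, this]
    · rw [div_le_one (by positivity)]
      linarith
  · have hc : (A.card : ℝ) + 1 ≤ Kest := by exact_mod_cast (by omega : A.card + 1 ≤ Kest)
    refine le_trans (measureReal_mono fun h hh => ?_) (measureReal_sum_norm_sq_ge A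
      (x := (2 * Kest - 1) / (2 * A.card)) ?_)
    · have h2 := hh.1.le
      rw [le_div_iff₀ hL0] at h2
      have := hcast (Kest - 1 / 2)
      rw [show 2 * ((Kest : ℝ) - 1 / 2) = 2 * Kest - 1 by ring] at this
      rwa [Set.mem_ofPred_eq, this]
    · rw [one_le_div (by positivity)]
      linarith

/-! ### White laws and asymptotic orthogonality -/

open scoped ComplexConjugate Pointwise

/-- A law on `ℂⁿ` is white of power `q` if its coordinates are square integrable and
uncorrelated with second moment `q`. -/
structure IsWhite {n : ℕ} (q : ℝ) (μ : Measure (Codeword n)) : Prop where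
  memLp : ∀ i, MemLp (fun c : Codeword n => c i) 2 μ
  moment : ∀ i j, ∫ c, c i * conj (c j) ∂μ = if i = j then (q : ℂ) else 0

lemma IsWhite.integrable_mul {n : ℕ} {q : ℝ} {μ : Measure (Codeword n)} (h : IsWhite q μ)
    (i j : Fin n) : Integrable (fun c : Codeword n => c i * conj (c j)) μ :=
  (h.memLp i).integrable_mul (h.memLp j).star

lemma ofReal_norm_inner_sq {n : ℕ} (x y : Codeword n) :
    ((‖inner ℂ x y‖ ^ 2 : ℝ) : ℂ) =
      ∑ i, ∑ j, (x j * conj (x i)) * (y i * conj (y j)) := by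
  push_cast
  rw [← Complex.mul_conj', PiLp.inner_apply, map_sum, Finset.sum_mul_sum]
  refine Finset.sum_congr rfl fun i _ => Finset.sum_congr rfl fun j _ => ?_
  simp only [RCLike.inner_apply, map_mul, RingHomCompTriple.comp_apply, RingHom.id_apply]
  ring

lemma IsWhite.integrable_norm_inner_sq {n : ℕ} {q r : ℝ} {μ ν : Measure (Codeword n)}
    [SFinite μ] [SFinite ν] (hμ : IsWhite q μ) (hν : IsWhite r ν) :
    Integrable (fun x : Codeword n × Codeword n => ‖inner ℂ x.1 x.2‖ ^ 2) (μ.prod ν) := by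
  have h : Integrable (fun x : Codeword n × Codeword n => ((‖inner ℂ x.1 x.2‖ ^ 2 : ℝ) : ℂ))
      (μ.prod ν) := by
    simp_rw [ofReal_norm_inner_sq]
    exact integrable_finsetSum _ fun i _ => integrable_finsetSum _ fun j _ =>
      (hμ.integrable_mul j i).mul_prod (hν.integrable_mul i j)
  exact h.re

/-- In the double sum over coordinates the means factor by independence, and whiteness leaves only
the `n` diagonal terms. -/
lemma IsWhite.integral_norm_inner_sq {n : ℕ} {q r : ℝ} {μ ν : Measure (Codeword n)}
    [SFinite μ] [SFinite ν] (hμ : IsWhite q μ) (hν : IsWhite r ν) :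
    ∫ x, ‖inner ℂ x.1 x.2‖ ^ 2 ∂μ.prod ν = n * (q * r) := by
  have hint : ∀ i j, Integrable (fun x : Codeword n × Codeword n =>
      (x.1 j * conj (x.1 i)) * (x.2 i * conj (x.2 j))) (μ.prod ν) := fun i j =>
    (hμ.integrable_mul j i).mul_prod (hν.integrable_mul i j)
  rw [← Complex.ofReal_inj, ← integral_complex_ofReal]
  simp_rw [ofReal_norm_inner_sq]
  rw [integral_finsetSum _ fun i _ => integrable_finsetSum _ fun j _ => hint i j]
  have h2 : ∀ i j, ∫ x : Codeword n × Codeword n,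
      (x.1 j * conj (x.1 i)) * (x.2 i * conj (x.2 j)) ∂μ.prod ν =
        if i = j then (q * r : ℂ) else 0 := fun i j => by
    rw [integral_prod_mul (fun x : Codeword n => x j * conj (x i))
      (fun y : Codeword n => y i * conj (y j)), hμ.moment, hν.moment]
    by_cases hij : i = j
    · simp [hij]
    · simp [hij]
  have h1 : ∀ i, ∫ x : Codeword n × Codeword n,
      ∑ j, (x.1 j * conj (x.1 i)) * (x.2 i * conj (x.2 j)) ∂μ.prod ν = q * r := fun i => by
    rw [integral_finsetSum _ fun j _ => hint i j]
    simp [h2]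
  simp [h1]

/-- Markov's inequality for the squared inner product: its mean is of order `n`, the threshold of
order `n ^ 2`. -/
lemma IsWhite.measureReal_inner_ge {n : ℕ} {q r : ℝ} {μ ν : Measure (Codeword n)}
    [IsProbabilityMeasure μ] [IsProbabilityMeasure ν] (hμ : IsWhite q μ) (hν : IsWhite r ν)
    (hn : 1 ≤ n) {ε : ℝ} (hε : 0 < ε) :
    (μ.prod ν).real {x | n * ε ≤ ‖inner ℂ x.1 x.2‖} ≤ q * r / ε ^ 2 / n := by
  have h := mul_meas_ge_le_integral_of_nonneg (.of_forall fun x => by positivity)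
    (hμ.integrable_norm_inner_sq hν) ((n * ε) ^ 2)
  rw [hμ.integral_norm_inner_sq hν] at h
  have hn0 : (0 : ℝ) < n := by positivity
  have hset : {x : Codeword n × Codeword n | n * ε ≤ ‖inner ℂ x.1 x.2‖} =
      {x | (n * ε) ^ 2 ≤ ‖inner ℂ x.1 x.2‖ ^ 2} := by
    ext x
    exact (sq_le_sq₀ (by positivity) (norm_nonneg _)).symm
  rw [hset, div_div, le_div_iff₀ (by positivity)]
  refine le_of_mul_le_mul_left (h.trans' (le_of_eq ?_)) hn0
  ring

lemma measurePreserving_pi_pair {ι α : Type*} [Fintype ι] [MeasurableSpace α] (μ : Measure α)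
    [IsProbabilityMeasure μ] {i j : ι} (hij : i ≠ j) :
    MeasurePreserving (fun c : ι → α => (c i, c j)) (Measure.pi fun _ => μ) (μ.prod μ) := by
  refine ⟨by fun_prop, ?_⟩
  have h := (iIndepFun_pi (μ := fun _ : ι => μ) (X := fun _ => id)
    (fun _ => aemeasurable_id)).indepFun hij
  simp only [id] at h
  rw [indepFun_iff_map_prod_eq_prod_map_map (measurable_pi_apply i).aemeasurable
    (measurable_pi_apply j).aemeasurable] at h
  have he := fun i => (measurePreserving_eval (fun _ : ι => μ) i).map_eq
  rw [h]
  exact congrArg₂ Measure.prod (he i) (he j)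

/-! ### Gaussian and spherical codewords -/

lemma measurePreserving_toLp_gaussianCodeword (Q : ℝ) (n : ℕ) :
    MeasurePreserving (WithLp.toLp 2) (Measure.pi fun _ : Fin n => complexGaussian Q.toNNReal)
      (gaussianCodeword Q n) :=
  ⟨by fun_prop, rfl⟩

instance (Q : ℝ) (n : ℕ) : IsProbabilityMeasure (gaussianCodeword Q n) :=
  Measure.isProbabilityMeasure_map (by fun_prop)

lemma measurePreserving_gaussianCodeword_apply (Q : ℝ) {n : ℕ} (i : Fin n) :
    MeasurePreserving (fun c : Codeword n => c i) (gaussianCodeword Q n)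
      (complexGaussian Q.toNNReal) := by
  refine ⟨by fun_prop, ?_⟩
  rw [gaussianCodeword, Measure.map_map (by fun_prop) (by fun_prop)]
  exact (measurePreserving_eval (fun _ : Fin n => complexGaussian Q.toNNReal) i).map_eq

lemma measurePreserving_gaussianCodeword_pair (Q : ℝ) {n : ℕ} {i j : Fin n} (hij : i ≠ j) :
    MeasurePreserving (fun c : Codeword n => (c i, c j)) (gaussianCodeword Q n)
      ((complexGaussian Q.toNNReal).prod (complexGaussian Q.toNNReal)) := by
  refine ⟨by fun_prop, ?_⟩
  rw [gaussianCodeword, Measure.map_map (by fun_prop) (by fun_prop)]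
  exact (measurePreserving_pi_pair (complexGaussian Q.toNNReal) hij).map_eq

lemma integral_mul_conj_complexGaussian (v : ℝ≥0) :
    ∫ z, z * conj z ∂complexGaussian v = v := by
  simp_rw [Complex.mul_conj']
  have := integral_norm_sq_complexGaussian v
  rw [← Complex.ofReal_inj, ← integral_complex_ofReal] at this
  simpa using this

lemma isWhite_gaussianCodeword {Q : ℝ} (hQ : 0 ≤ Q) (n : ℕ) : IsWhite Q (gaussianCodeword Q n) where
  memLp i := (memLp_complexGaussian Q.toNNReal (p := 2) (by simp)).comp_measurePreserving
    (measurePreserving_gaussianCodeword_apply Q i)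
  moment i j := by
    split_ifs with hij
    · subst hij
      have hm := measurePreserving_gaussianCodeword_apply Q i
      have := integral_map (μ := gaussianCodeword Q n) hm.measurable.aemeasurable
        (f := fun z : ℂ => z * conj z) (by fun_prop)
      rw [← this, hm.map_eq, integral_mul_conj_complexGaussian]
      exact congrArg Complex.ofReal (Real.coe_toNNReal Q hQ)
    · have hm := measurePreserving_gaussianCodeword_pair Q hij
      have := integral_map (μ := gaussianCodeword Q n) hm.measurable.aemeasurable
        (f := fun z : ℂ × ℂ => z.1 * conj z.2) (by fun_prop)
      rw [← this, hm.map_eq, integral_prod_mul (fun z : ℂ => z) (fun z : ℂ => conj z),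
        integral_id_complexGaussian, zero_mul]

/-- Chebyshev's inequality: the energy is a sum of `n` independent terms of mean `Q` and finite
variance. -/
lemma gaussianCodeword_measureReal_norm_sq {Q : ℝ} (hQ : 0 ≤ Q) {n : ℕ} (hn : 1 ≤ n)
    {ε : ℝ} (hε : 0 < ε) :
    (gaussianCodeword Q n).real {c | n * ε ≤ |‖c‖ ^ 2 - n * Q|} ≤
      Var[fun z : ℂ => ‖z‖ ^ 2; complexGaussian Q.toNNReal] / ε ^ 2 / n := by
  have hn0 : (0 : ℝ) < n := by positivity
  let ν := Measure.pi fun _ : Fin n => complexGaussian Q.toNNReal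
  let X : (Fin n → ℂ) → ℝ := ∑ i, fun c => ‖c i‖ ^ 2
  have hX : MemLp X 2 ν := memLp_finsetSum' _ fun i _ =>
    (memLp_norm_sq_complexGaussian Q.toNNReal).comp_measurePreserving (measurePreserving_eval _ i)
  have hmean : ν[X] = n * Q := by
    simp only [X, Finset.sum_apply]
    rw [integral_finsetSum]
    · have : ∀ i : Fin n, ∫ c, ‖c i‖ ^ 2 ∂ν = Q := fun i => by
        have hm := measurePreserving_eval (fun _ : Fin n => complexGaussian Q.toNNReal) i
        have := integral_map (μ := ν) hm.measurable.aemeasurable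
          (f := fun z : ℂ => ‖z‖ ^ 2) (by fun_prop)
        rw [hm.map_eq, integral_norm_sq_complexGaussian, Real.coe_toNNReal Q hQ] at this
        exact this.symm
      simp [this]
    · intro i _
      exact ((memLp_norm_sq_complexGaussian Q.toNNReal).comp_measurePreserving
        (measurePreserving_eval _ i)).integrable (by norm_num)
  have hvar : Var[X; ν] = n * Var[fun z : ℂ => ‖z‖ ^ 2; complexGaussian Q.toNNReal] := by
    have := variance_sum_pi (μ := fun _ : Fin n => complexGaussian Q.toNNReal)
      (X := fun _ z => ‖z‖ ^ 2) (fun _ => memLp_norm_sq_complexGaussian Q.toNNReal)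
    simpa using this
  have h := meas_ge_le_variance_div_sq hX (c := n * ε) (by positivity)
  rw [hmean, hvar] at h
  have hpre : gaussianCodeword Q n {c | n * ε ≤ |‖c‖ ^ 2 - n * Q|} =
      ν {c | n * ε ≤ |X c - n * Q|} := by
    rw [← (measurePreserving_toLp_gaussianCodeword Q n).measure_preimage
      (measurableSet_le (by fun_prop) (by fun_prop)).nullMeasurableSet]
    simp [X, EuclideanSpace.norm_sq_eq, ν]
  rw [measureReal_def, hpre]
  refine (ENNReal.toReal_le_of_le_ofReal ?_ h).trans_eq ?_
  · exact div_nonneg (mul_nonneg hn0.le (variance_nonneg _ _)) (by positivity)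
  · field_simp

/-- Up to a constant, surface measure is the volume of the cone over a set; a linear isometry
preserves volume and commutes with taking cones. -/
lemma measurePreserving_toSphere {n : ℕ} (U : Codeword n ≃ₗᵢ[ℝ] Codeword n) :
    MeasurePreserving (fun u : Metric.sphere (0 : Codeword n) 1 =>
        (⟨U u, by simp⟩ : Metric.sphere (0 : Codeword n) 1))
      (volume : Measure (Codeword n)).toSphere (volume : Measure (Codeword n)).toSphere := by
  have hmeas : Measurable (fun u : Metric.sphere (0 : Codeword n) 1 =>
        (⟨U u, by simp⟩ : Metric.sphere (0 : Codeword n) 1)) := by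
    refine Continuous.measurable ?_
    have := U.continuous
    fun_prop
  refine ⟨hmeas, Measure.ext fun s hs => ?_⟩
  rw [Measure.map_apply hmeas hs, Measure.toSphere_apply' _ (hmeas hs),
    Measure.toSphere_apply' _ hs, ← (U.measurePreserving).measure_preimage_emb
      U.toMeasurableEquiv.measurableEmbedding (Set.Ioo (0 : ℝ) 1 • (Subtype.val '' s))]
  congr 2
  ext x
  simp only [Set.mem_smul, Set.mem_preimage, Set.mem_image]
  constructor
  · rintro ⟨r, hr, _, ⟨u, hu, rfl⟩, rfl⟩
    exact ⟨r, hr, _, ⟨_, hu, rfl⟩, by simp⟩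
  · rintro ⟨r, hr, _, ⟨u, hu, rfl⟩, hx⟩
    refine ⟨r, hr, U.symm u, ⟨⟨U.symm u, by simp⟩, by simpa using hu, rfl⟩, ?_⟩
    apply U.injective
    simpa using hx

lemma measurePreserving_sphericalCodeword (Q : ℝ) {n : ℕ} (U : Codeword n ≃ₗᵢ[ℝ] Codeword n) :
    MeasurePreserving U (sphericalCodeword Q n) (sphericalCodeword Q n) := by
  have hU := measurePreserving_toSphere U
  have hm : Measurable fun u : Metric.sphere (0 : Codeword n) 1 => √(n * Q) • (u : Codeword n) := by
    fun_prop
  refine ⟨U.continuous.measurable, ?_⟩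
  rw [sphericalCodeword, Measure.map_map U.continuous.measurable hm]
  conv_rhs => rw [← hU.map_eq, ← Measure.map_smul, Measure.map_map hm hU.measurable, hU.map_eq]
  congr 1
  ext u : 1
  simp

lemma isProbabilityMeasure_sphericalCodeword (Q : ℝ) {n : ℕ} (hn : 1 ≤ n) :
    IsProbabilityMeasure (sphericalCodeword Q n) := by
  have : Nonempty (Fin n) := ⟨⟨0, hn⟩⟩
  have : IsProbabilityMeasure (((volume : Measure (Codeword n)).toSphere Set.univ)⁻¹ •
      (volume : Measure (Codeword n)).toSphere) := by
    refine ⟨?_⟩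
    rw [Measure.smul_apply, smul_eq_mul, ENNReal.inv_mul_cancel _ (measure_ne_top _ _)]
    exact fun h => Measure.toSphere_ne_zero _ (Measure.measure_univ_eq_zero.1 h)
  exact Measure.isProbabilityMeasure_map (by fun_prop)

lemma sphericalCodeword_ae_norm_sq {Q : ℝ} (hQ : 0 ≤ Q) (n : ℕ) :
    ∀ᵐ c ∂sphericalCodeword Q n, ‖c‖ ^ 2 = n * Q := by
  refine (ae_map_iff (by fun_prop) (measurableSet_eq_fun (by fun_prop) (by fun_prop))).2 ?_
  refine .of_forall fun u => ?_
  rw [norm_smul, norm_eq_of_mem_sphere, mul_one, Real.norm_eq_abs, sq_abs,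
    Real.sq_sqrt (by positivity)]

/-- By symmetry of the sphere: swapping coordinates makes the diagonal moments equal, and their sum
is `n * Q`; flipping the sign of one coordinate negates an off-diagonal moment, which therefore
vanishes. -/
lemma isWhite_sphericalCodeword {Q : ℝ} (hQ : 0 ≤ Q) {n : ℕ} (hn : 1 ≤ n) :
    IsWhite Q (sphericalCodeword Q n) := by
  have := isProbabilityMeasure_sphericalCodeword Q hn
  have hLp : ∀ i, MemLp (fun c : Codeword n => c i) 2 (sphericalCodeword Q n) := fun i => by
    refine MemLp.of_bound (by fun_prop) (√(n * Q)) ?_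
    filter_upwards [sphericalCodeword_ae_norm_sq hQ n] with c hc
    rw [← hc, Real.sqrt_sq (norm_nonneg _)]
    exact PiLp.norm_apply_le c i
  have hmap : ∀ (U : Codeword n ≃ₗᵢ[ℝ] Codeword n) (i j : Fin n),
      ∫ c, U c i * conj (U c j) ∂sphericalCodeword Q n =
        ∫ c, c i * conj (c j) ∂sphericalCodeword Q n := fun U i j => by
    have hm := measurePreserving_sphericalCodeword Q U
    have := integral_map (μ := sphericalCodeword Q n) hm.measurable.aemeasurable
      (f := fun c : Codeword n => c i * conj (c j)) (by fun_prop)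
    rw [hm.map_eq] at this
    exact this.symm
  have hdiag : ∀ i j : Fin n, ∫ c, c i * conj (c i) ∂sphericalCodeword Q n =
      ∫ c, c j * conj (c j) ∂sphericalCodeword Q n := fun i j => by
    rw [← hmap (LinearIsometryEquiv.piLpCongrLeft 2 ℝ ℂ (Equiv.swap i j)) i i]
    simp [LinearIsometryEquiv.piLpCongrLeft_apply]
  refine ⟨hLp, fun i j => ?_⟩
  split_ifs with hij
  · subst hij
    have hsum : ∑ j, ∫ c, c j * conj (c j) ∂sphericalCodeword Q n = n * (Q : ℂ) := by
      rw [← integral_finsetSum _ fun j _ => show Integrable (fun c : Codeword n => c j * conj (c j)) _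
        from (hLp j).integrable_mul (hLp j).star]
      rw [integral_congr_ae (g := fun _ => ((n * Q : ℝ) : ℂ))]
      · simp
      · filter_upwards [sphericalCodeword_ae_norm_sq hQ n] with c hc
        rw [← hc, EuclideanSpace.norm_sq_eq]
        push_cast
        simp_rw [Complex.mul_conj']
    simp_rw [fun j => hdiag j i] at hsum
    rw [Finset.sum_const, Finset.card_univ, Fintype.card_fin, nsmul_eq_mul] at hsum
    exact mul_left_cancel₀ (by exact_mod_cast (by omega : n ≠ 0)) hsum
  · let U : Codeword n ≃ₗᵢ[ℝ] Codeword n := LinearIsometryEquiv.piLpCongrRight 2 fun k =>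
      if k = i then LinearIsometryEquiv.neg ℝ else LinearIsometryEquiv.refl ℝ ℂ
    have h := hmap U i j
    have hU : ∀ c, U c i * conj (U c j) = -(c i * conj (c j)) := fun c => by
      simp [U, LinearIsometryEquiv.piLpCongrRight_apply, Ne.symm hij]
    simp_rw [hU] at h
    rw [integral_neg] at h
    exact self_eq_neg.1 h.symm

/-! ### Code families -/

/-- The properties of a family of codeword laws, one for each block length, that determine the
limiting error probabilities: white of power `Q`, with normalized energy that concentrates at `Q`,
and asymptotically satisfying the power constraint `P`. -/
structure IsCodeFamily (P Q : ℝ) (μ : (n : ℕ) → Measure (Codeword n)) : Prop where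
  isProbabilityMeasure : ∀ n, 1 ≤ n → IsProbabilityMeasure (μ n)
  isWhite : ∀ n, 1 ≤ n → IsWhite Q (μ n)
  tendsto_norm_sq : ∀ ε : ℝ, 0 < ε →
    Tendsto (fun n : ℕ => (μ n).real {c | n * ε ≤ |‖c‖ ^ 2 - n * Q|}) atTop (𝓝 0)
  tendsto_power : Tendsto (fun n : ℕ => (μ n).real {c | n * P < ‖c‖ ^ 2}) atTop (𝓝 0)

lemma tendsto_gaussianCodeword_norm_sq {Q : ℝ} (hQ : 0 ≤ Q) {ε : ℝ} (hε : 0 < ε) :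
    Tendsto (fun n : ℕ => (gaussianCodeword Q n).real {c | n * ε ≤ |‖c‖ ^ 2 - n * Q|})
      atTop (𝓝 0) :=
  squeeze_zero' (.of_forall fun _ => measureReal_nonneg)
    ((eventually_ge_atTop 1).mono fun _ hn => gaussianCodeword_measureReal_norm_sq hQ hn hε)
    (tendsto_const_div_atTop_nhds_zero_nat _)

lemma isCodeFamily_gaussianCodeword {P Q : ℝ} (hQ : 0 < Q) (hQP : Q < P) :
    IsCodeFamily P Q (gaussianCodeword Q) where
  isProbabilityMeasure := fun _ _ => inferInstance
  isWhite := fun _ _ => isWhite_gaussianCodeword hQ.le _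
  tendsto_norm_sq ε hε := tendsto_gaussianCodeword_norm_sq hQ.le hε
  tendsto_power := by
    -- As `Q < P`, violating the power constraint is an energy deviation of at least `n * (P - Q)`.
    refine squeeze_zero (fun n => measureReal_nonneg) (fun n => measureReal_mono fun c hc => ?_)
      (tendsto_gaussianCodeword_norm_sq hQ.le (sub_pos.2 hQP))
    have hc' : (n : ℝ) * P < ‖c‖ ^ 2 := hc
    rw [Set.mem_ofPred_eq, mul_sub]
    exact le_abs.2 (.inl (by linarith))

/-- The energy is almost surely exactly `n * Q`, so both events are null. `Q = P` is allowed because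
only energies strictly above `n * P` violate the constraint. -/
lemma isCodeFamily_sphericalCodeword {P Q : ℝ} (hQ : 0 < Q) (hQP : Q ≤ P) :
    IsCodeFamily P Q (sphericalCodeword Q) where
  isProbabilityMeasure n hn := isProbabilityMeasure_sphericalCodeword Q hn
  isWhite n hn := isWhite_sphericalCodeword hQ.le hn
  tendsto_norm_sq ε hε := by
    refine tendsto_const_nhds.congr' ((eventually_ge_atTop 1).mono fun n hn => ?_)
    have hn0 : (0 : ℝ) < n := by positivity
    dsimp only
    rw [eq_comm, measureReal_def, measure_eq_zero_iff_ae_notMem.2, ENNReal.toReal_zero]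
    filter_upwards [sphericalCodeword_ae_norm_sq hQ.le n] with c hc
    simpa [hc] using mul_pos hn0 hε
  tendsto_power := by
    refine tendsto_const_nhds.congr fun n => ?_
    rw [eq_comm, measureReal_def, measure_eq_zero_iff_ae_notMem.2, ENNReal.toReal_zero]
    filter_upwards [sphericalCodeword_ae_norm_sq hQ.le n] with c hc
    simpa [hc] using mul_le_mul_of_nonneg_left hQP n.cast_nonneg

/-! ### Received energy of typical codebooks and noise -/

/-- Expand the norm through the Gram matrix, whose entries are within `δ` of a diagonal one. The
coefficients are arbitrary, which separates the fading from codebook and noise. -/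
lemma abs_norm_sum_smul_sq_sub_le {ι E : Type*} [Fintype ι] [DecidableEq ι]
    [NormedAddCommGroup E] [InnerProductSpace ℂ E] (v : ι → E) (q : ι → ℝ) (a : ι → ℂ) {δ : ℝ}
    (h : ∀ i j, ‖inner ℂ (v i) (v j) - (if i = j then (q i : ℂ) else 0)‖ ≤ δ) :
    |‖∑ i, a i • v i‖ ^ 2 - ∑ i, q i * ‖a i‖ ^ 2| ≤ δ * (∑ i, ‖a i‖) ^ 2 := by
  have hdiag : ((∑ i, q i * ‖a i‖ ^ 2 : ℝ) : ℂ) =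
      ∑ i, ∑ j, conj (a i) * a j * (if i = j then (q i : ℂ) else 0) := by
    push_cast
    refine Finset.sum_congr rfl fun i _ => ?_
    simp [← Complex.mul_conj']
    ring
  have hnorm : ((‖∑ i, a i • v i‖ ^ 2 : ℝ) : ℂ) =
      ∑ i, ∑ j, conj (a i) * a j * inner ℂ (v i) (v j) := by
    push_cast
    refine (inner_self_eq_norm_sq_to_K (𝕜 := ℂ) (∑ i, a i • v i)).symm.trans ?_
    rw [sum_inner]
    refine Finset.sum_congr rfl fun i _ => ?_
    rw [inner_sum]
    refine Finset.sum_congr rfl fun j _ => ?_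
    rw [inner_smul_left, inner_smul_right, mul_assoc]
  rw [← Real.norm_eq_abs, ← Complex.norm_real, Complex.ofReal_sub, hdiag, hnorm]
  simp_rw [← Finset.sum_sub_distrib, ← mul_sub]
  rw [sq, Finset.sum_mul_sum, Finset.mul_sum]
  refine norm_sum_le_of_le _ fun i _ => ?_
  rw [Finset.mul_sum]
  refine norm_sum_le_of_le _ fun j _ => ?_
  rw [norm_mul, norm_mul, RCLike.norm_conj, mul_comm]
  exact mul_le_mul_of_nonneg_right (h i j) (by positivity)

/-- The sample space of the model at block length `n`. -/
abbrev Outcome (K M L n : ℕ) : Type :=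
  (Fin M → Codeword n) × (Fin K → Fin M) × (Fin K → Fin L → ℂ) × (Fin n → Fin L → ℂ)

/-- The noise at antenna `l`. -/
def noiseColumn {L n : ℕ} (z : Fin n → Fin L → ℂ) (l : Fin L) : Codeword n :=
  WithLp.toLp 2 fun i => z i l

/-- The vectors that antenna `l` superimposes: the codewords and, with index `none`, the noise. -/
def superposed {M L n : ℕ} (c : Fin M → Codeword n) (z : Fin n → Fin L → ℂ) (l : Fin L) :
    Option (Fin M) → Codeword n :=
  fun j => j.elim (noiseColumn z l) c

/-- The coefficients with which antenna `l` superimposes the codewords and the noise. -/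
noncomputable def coefficient {K M L : ℕ} (A : Finset (Fin K)) (W : Fin K → Fin M)
    (h : Fin K → Fin L → ℂ) (l : Fin L) : Option (Fin M) → ℂ :=
  fun j => j.elim 1 fun m => aggregate A W h m l

/-- The squared `ℓ¹` norm of the superposition coefficients, averaged over the antennas. -/
noncomputable def coefficientBound {K M L : ℕ} (A : Finset (Fin K)) (W : Fin K → Fin M)
    (h : Fin K → Fin L → ℂ) : ℝ :=
  (∑ l, (∑ j, ‖coefficient A W h l j‖) ^ 2) / L

/-- Codebook and noise deviate by less than `ε` from the power constraint and from being
orthogonal with normalized energies `Q` and `1`. -/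
structure IsTypical {M L n : ℕ} (P Q ε : ℝ) (c : Fin M → Codeword n) (z : Fin n → Fin L → ℂ) :
    Prop where
  power : ∀ m, ‖c m‖ ^ 2 ≤ n * P
  norm_codeword : ∀ m, |‖c m‖ ^ 2 - n * Q| < n * ε
  inner_codeword : ∀ m m', m ≠ m' → ‖inner ℂ (c m) (c m')‖ < n * ε
  norm_noise : ∀ l, |‖noiseColumn z l‖ ^ 2 - n * (1 : ℝ)| < n * ε
  inner_noise : ∀ m l, ‖inner ℂ (c m) (noiseColumn z l)‖ < n * ε

lemma IsTypical.transmitted_eq {M L n : ℕ} {P Q ε : ℝ} {c : Fin M → Codeword n}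
    {z : Fin n → Fin L → ℂ} (h : IsTypical P Q ε c z) (m : Fin M) : transmitted P (c m) = c m :=
  if_pos (h.power m)

lemma sum_coefficient_smul {K M L n : ℕ} (A : Finset (Fin K)) (c : Fin M → Codeword n)
    (W : Fin K → Fin M) (h : Fin K → Fin L → ℂ) (z : Fin n → Fin L → ℂ) (l : Fin L) (i : Fin n) :
    (∑ j, coefficient A W h l j • superposed c z l j) i =
      (∑ k ∈ A, h k l * c (W k) i) + z i l := by
  rw [Fintype.sum_option, add_comm, ← Finset.sum_fiberwise A W]
  simp only [coefficient, superposed, Option.elim, one_smul, PiLp.add_apply, WithLp.ofLp_sum,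
    Finset.sum_apply, PiLp.smul_apply, noiseColumn, aggregate, Finset.sum_mul, smul_eq_mul]
  congr 1
  refine Finset.sum_congr rfl fun m _ => Finset.sum_congr rfl fun k hk => ?_
  rw [(Finset.mem_filter.1 hk).2]

lemma IsTypical.energy_eq {K M L n : ℕ} {P Q ε : ℝ} {A : Finset (Fin K)} {c : Fin M → Codeword n}
    {W : Fin K → Fin M} {h : Fin K → Fin L → ℂ} {z : Fin n → Fin L → ℂ}
    (ht : IsTypical P Q ε c z) :
    ∑ i, ∑ l, ‖received P A c W h z i l‖ ^ 2 =
      ∑ l, ‖∑ j, coefficient A W h l j • superposed c z l j‖ ^ 2 := by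
  rw [Finset.sum_comm]
  refine Finset.sum_congr rfl fun l _ => ?_
  rw [EuclideanSpace.norm_sq_eq]
  refine Finset.sum_congr rfl fun i _ => ?_
  rw [sum_coefficient_smul]
  simp [received, ht.transmitted_eq]

lemma IsTypical.gram {M L n : ℕ} {P Q ε : ℝ} {c : Fin M → Codeword n} {z : Fin n → Fin L → ℂ}
    (ht : IsTypical P Q ε c z) (l : Fin L) (i j : Option (Fin M)) :
    ‖inner ℂ (superposed c z l i) (superposed c z l j) -
      (if i = j then ((i.elim (n * 1) fun _ => n * Q : ℝ) : ℂ) else 0)‖ ≤ n * ε := by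
  have hself : ∀ (x : Codeword n) (r : ℝ), ‖inner ℂ x x - (r : ℂ)‖ = |‖x‖ ^ 2 - r| := fun x r => by
    rw [inner_self_eq_norm_sq_to_K, ← Real.norm_eq_abs, ← Complex.norm_real]
    push_cast
    rfl
  rcases i with _ | m <;> rcases j with _ | m'
  · rw [if_pos rfl, hself]
    exact (ht.norm_noise l).le
  · rw [if_neg (by simp), sub_zero, norm_inner_symm]
    exact (ht.inner_noise m' l).le
  · rw [if_neg (by simp), sub_zero]
    exact (ht.inner_noise m l).le
  · by_cases hm : m = m'
    · subst hm
      rw [if_pos rfl, hself]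
      exact (ht.norm_codeword m).le
    · rw [if_neg (by simpa using hm), sub_zero]
      exact (ht.inner_codeword m m' hm).le

lemma IsTypical.abs_energy_sub_le {K M L n : ℕ} {P Q ε : ℝ} {A : Finset (Fin K)}
    {c : Fin M → Codeword n} {W : Fin K → Fin M} {h : Fin K → Fin L → ℂ} {z : Fin n → Fin L → ℂ}
    (ht : IsTypical P Q ε c z) (hn : 1 ≤ n) (hL : 1 ≤ L) :
    |(∑ i, ∑ l, ‖received P A c W h z i l‖ ^ 2) / (n * L) - (1 + Q * fadingEnergy A W h)| ≤
      ε * coefficientBound A W h := by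
  have hn0 : (0 : ℝ) < n := by positivity
  have hL0 : (0 : ℝ) < L := by positivity
  rw [ht.energy_eq]
  have hl : ∀ l, |‖∑ j, coefficient A W h l j • superposed c z l j‖ ^ 2 -
      (n + n * Q * ∑ m, ‖aggregate A W h m l‖ ^ 2)| ≤
        n * ε * (∑ j, ‖coefficient A W h l j‖) ^ 2 := fun l => by
    have := abs_norm_sum_smul_sq_sub_le _ _ (coefficient A W h l) (ht.gram l)
    rw [Fintype.sum_option (f := fun i => _ * ‖coefficient A W h l i‖ ^ 2)] at this
    simpa [coefficient, ← Finset.mul_sum] using this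
  have hsum : |∑ l, ‖∑ j, coefficient A W h l j • superposed c z l j‖ ^ 2 -
      (n * L + n * Q * (L * fadingEnergy A W h))| ≤ n * ε * (L * coefficientBound A W h) := by
    rw [fadingEnergy, coefficientBound, mul_div_cancel₀ _ hL0.ne', mul_div_cancel₀ _ hL0.ne']
    have : (n * L + n * Q * ∑ l, ∑ m, ‖aggregate A W h m l‖ ^ 2 : ℝ) =
        ∑ l, (n + n * Q * ∑ m, ‖aggregate A W h m l‖ ^ 2) := by
      rw [Finset.sum_add_distrib, Finset.mul_sum]
      simp [mul_comm]
    rw [this, ← Finset.sum_sub_distrib, Finset.mul_sum]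
    exact (Finset.abs_sum_le_sum_abs _ _).trans (Finset.sum_le_sum fun l _ => hl l)
  have hnL : (0 : ℝ) < n * L := by positivity
  refine le_of_mul_le_mul_left ?_ hnL
  rw [← abs_of_pos hnL, ← abs_mul, abs_of_pos hnL, mul_sub, mul_div_cancel₀ _ hnL.ne']
  calc _ = _ := by ring_nf
    _ ≤ _ := hsum
    _ = _ := by ring

/-! ### The estimator as rounding -/

/-- Writing the normalized energy as `1 + Q * u`, the metric is `Q * |u - k|`, so the estimate is an
integer in `{0, …, K}` nearest to `u`. As `|u - t| < η` and `t` is farther than `η` from `Kest ± 1 /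
2`, both `u` and `t` lie strictly on the same side of each. -/
lemma IsEnergyEstimator.eq_iff {K L n Kest : ℕ} {Q : ℝ} (hQ : 0 < Q)
    {est : Matrix (Fin n) (Fin L) ℂ → ℕ} (hest : IsEnergyEstimator K Q est) (hKest : 1 ≤ Kest)
    (hKest' : Kest ≤ K) {Y : Matrix (Fin n) (Fin L) ℂ} {t η : ℝ}
    (hY : |(∑ i, ∑ l, ‖Y i l‖ ^ 2) / (n * L) - (1 + Q * t)| < Q * η)
    (h₁ : η < |t - (Kest - 1 / 2)|) (h₂ : η < |t - (Kest + 1 / 2)|) :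
    est Y = Kest ↔ t ∈ decisionRegion K Kest := by
  obtain ⟨u, hu⟩ : ∃ u : ℝ, (∑ i, ∑ l, ‖Y i l‖ ^ 2) / (n * L) = 1 + Q * u :=
    ⟨((∑ i, ∑ l, ‖Y i l‖ ^ 2) / (n * L) - 1) / Q, by field_simp; ring⟩
  have hmetric : ∀ k : ℕ, energyMetric Q Y k = Q * |u - k| := fun k => by
    rw [energyMetric, hu, ← abs_of_pos hQ, ← abs_mul, abs_of_pos hQ]
    congr 1
    ring
  have hut : |u - t| < η := by
    rw [hu, show 1 + Q * u - (1 + Q * t) = Q * (u - t) by ring, abs_mul, abs_of_pos hQ] at hY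
    exact lt_of_mul_lt_mul_left hY hQ.le
  obtain ⟨hle, hmin⟩ := hest Y
  simp only [hmetric, mul_le_mul_iff_right₀ hQ] at hmin
  rw [abs_lt] at hut
  rw [lt_abs] at h₁ h₂
  constructor
  · intro he
    rw [he] at hmin
    refine ⟨?_, fun hlt => ?_⟩
    -- The left neighbour is a candidate because `1 ≤ Kest`; the right one, below, only if `Kest <
    -- K`.
    · have h := hmin (Kest - 1) (by omega)
      rw [Nat.cast_sub hKest, Nat.cast_one] at h
      have : (Kest : ℝ) - 1 / 2 ≤ u := by
        by_contra! hc
        have h3 : u - Kest ≤ 0 := by linarith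
        rw [abs_of_nonpos h3, le_abs] at h
        rcases h with h | h <;> linarith
      rcases h₁ with h₁ | h₁ <;> linarith
    · have h := hmin (Kest + 1) (by omega)
      push_cast at h
      have : u ≤ (Kest : ℝ) + 1 / 2 := by
        by_contra! hc
        have h3 : 0 ≤ u - Kest := by linarith
        rw [abs_of_nonneg h3, le_abs] at h
        rcases h with h | h <;> linarith
      rcases h₂ with h₂ | h₂ <;> linarith
  · rintro ⟨hlo, hhi⟩
    have hlo' : (Kest : ℝ) - 1 / 2 < u := by
      rcases h₁ with h₁ | h₁ <;> linarith
    have h := hmin Kest hKest'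
    rcases lt_trichotomy (est Y) Kest with hlt | heq | hgt
    · have hc : (est Y : ℝ) + 1 ≤ Kest := by exact_mod_cast hlt
      have h3 : 0 ≤ u - est Y := by linarith
      rw [abs_of_nonneg h3, le_abs] at h
      rcases h with h | h <;> linarith
    · exact heq
    · have hc : (Kest : ℝ) + 1 ≤ est Y := by exact_mod_cast hgt
      have hhi' : u < (Kest : ℝ) + 1 / 2 := by
        have := hhi (by omega)
        rcases h₂ with h₂ | h₂ <;> linarith
      have h3 : u - est Y ≤ 0 := by linarith
      rw [abs_of_nonpos h3, le_abs] at h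
      rcases h with h | h <;> linarith

lemma continuous_coefficientBound {K M L : ℕ} (A : Finset (Fin K)) (W : Fin K → Fin M) :
    Continuous fun h : Fin K → Fin L → ℂ => coefficientBound A W h := by
  have := fun m l => continuous_aggregate (L := L) A W m l
  unfold coefficientBound
  simp only [Fintype.sum_option, coefficient, Option.elim]
  fun_prop

lemma measurable_coefficientBound {K M L : ℕ} (A : Finset (Fin K)) :
    Measurable fun x : (Fin K → Fin M) × (Fin K → Fin L → ℂ) => coefficientBound A x.1 x.2 :=
  measurable_from_prod_countable_right fun W => (continuous_coefficientBound A W).measurable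

/-! ### Typicality has probability tending to one -/

section Marginals

variable {K M L n : ℕ} {μ : Measure (Codeword n)}

lemma isProbabilityMeasure_jointLaw [IsProbabilityMeasure μ] (hM : 1 ≤ M) : IsProbabilityMeasure (jointLaw K M L μ) := by
  have := isProbabilityMeasure_uniformOn_fin hM
  unfold jointLaw
  infer_instance

lemma measurePreserving_codebook (hM : 1 ≤ M) :
    MeasurePreserving (fun ω : Outcome K M L n => ω.1) (jointLaw K M L μ)
      (Measure.pi fun _ => μ) := by
  have := isProbabilityMeasure_uniformOn_fin hM
  exact measurePreserving_fst

lemma measurePreserving_noise [IsProbabilityMeasure μ] (hM : 1 ≤ M) :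
    MeasurePreserving (fun ω : Outcome K M L n => ω.2.2.2) (jointLaw K M L μ)
      (Measure.pi fun _ => Measure.pi fun _ => complexGaussian 1) := by
  have := isProbabilityMeasure_uniformOn_fin hM
  exact measurePreserving_snd.comp (measurePreserving_snd.comp measurePreserving_snd)

lemma measurePreserving_message_fading [IsProbabilityMeasure μ] (hM : 1 ≤ M) :
    MeasurePreserving (fun ω : Outcome K M L n => (ω.2.1, ω.2.2.1)) (jointLaw K M L μ)
      ((messageLaw K M).prod (fadingLaw K L)) := by
  have := isProbabilityMeasure_uniformOn_fin hM
  exact ((MeasurePreserving.id _).prod measurePreserving_fst).comp measurePreserving_snd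

lemma measurePreserving_codebook_noise [IsProbabilityMeasure μ] (hM : 1 ≤ M) :
    MeasurePreserving (fun ω : Outcome K M L n => (ω.1, ω.2.2.2)) (jointLaw K M L μ)
      ((Measure.pi fun _ => μ).prod (Measure.pi fun _ => Measure.pi fun _ => complexGaussian 1)) := by
  have := isProbabilityMeasure_uniformOn_fin hM
  exact (MeasurePreserving.id _).prod (measurePreserving_snd.comp measurePreserving_snd)

/-- Lets each noise column be treated as one more Gaussian codeword, of power `1`. -/
lemma measurePreserving_noiseColumn (l : Fin L) :
    MeasurePreserving (fun z : Fin n → Fin L → ℂ => noiseColumn z l)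
      (Measure.pi fun _ => Measure.pi fun _ => complexGaussian 1) (gaussianCodeword 1 n) := by
  have h := measurePreserving_toLp_gaussianCodeword 1 n
  rw [Real.toNNReal_one] at h
  exact h.comp (measurePreserving_pi (f := fun _ => Function.eval l) _ _
    fun _ => measurePreserving_eval (fun _ : Fin L => complexGaussian 1) l)

end Marginals

lemma tendsto_measureReal_preimage {Ω X : ℕ → Type*} [∀ n, MeasurableSpace (Ω n)]
    [∀ n, MeasurableSpace (X n)] {μ : ∀ n, Measure (Ω n)} {ν : ∀ n, Measure (X n)}
    {f : ∀ n, Ω n → X n} (hf : ∀ n, 1 ≤ n → MeasurePreserving (f n) (μ n) (ν n))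
    {s : ∀ n, Set (X n)} (hs : ∀ n, MeasurableSet (s n))
    (h : Tendsto (fun n => (ν n).real (s n)) atTop (𝓝 0)) :
    Tendsto (fun n => (μ n).real (f n ⁻¹' s n)) atTop (𝓝 0) :=
  h.congr' ((eventually_ge_atTop 1).mono fun n hn =>
    ((hf n hn).measureReal_preimage (hs n).nullMeasurableSet).symm)

lemma tendsto_measureReal_iUnion {ι : Type*} [Fintype ι] {Ω : ℕ → Type*}
    [∀ n, MeasurableSpace (Ω n)] {μ : ∀ n, Measure (Ω n)} {s : ∀ n, ι → Set (Ω n)}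
    (h : ∀ i, Tendsto (fun n => (μ n).real (s n i)) atTop (𝓝 0)) :
    Tendsto (fun n => (μ n).real (⋃ i, s n i)) atTop (𝓝 0) := by
  refine squeeze_zero (fun n => measureReal_nonneg) (fun n => measureReal_iUnion_fintype_le _) ?_
  simpa using tendsto_finsetSum Finset.univ fun i _ => h i

lemma tendsto_measureReal_union {Ω : ℕ → Type*} [∀ n, MeasurableSpace (Ω n)]
    {μ : ∀ n, Measure (Ω n)} {s t : ∀ n, Set (Ω n)}
    (hs : Tendsto (fun n => (μ n).real (s n)) atTop (𝓝 0))
    (ht : Tendsto (fun n => (μ n).real (t n)) atTop (𝓝 0)) :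
    Tendsto (fun n => (μ n).real (s n ∪ t n)) atTop (𝓝 0) :=
  squeeze_zero (fun _ => measureReal_nonneg) (fun _ => measureReal_union_le _ _)
    (by simpa using hs.add ht)

lemma measurableSet_le_norm_inner (n : ℕ) (r : ℝ) :
    MeasurableSet {x : Codeword n × Codeword n | r ≤ ‖inner ℂ x.1 x.2‖} :=
  (isClosed_le continuous_const (by fun_prop)).measurableSet

lemma tendsto_measureReal_inner {Q R : ℝ} {μ ν : (n : ℕ) → Measure (Codeword n)}
    (hμ : ∀ n, 1 ≤ n → IsProbabilityMeasure (μ n)) (hμ' : ∀ n, 1 ≤ n → IsWhite Q (μ n))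
    (hν : ∀ n, 1 ≤ n → IsProbabilityMeasure (ν n)) (hν' : ∀ n, 1 ≤ n → IsWhite R (ν n))
    {ε : ℝ} (hε : 0 < ε) :
    Tendsto (fun n : ℕ => ((μ n).prod (ν n)).real {x | n * ε ≤ ‖inner ℂ x.1 x.2‖})
      atTop (𝓝 0) := by
  refine squeeze_zero' (.of_forall fun n => measureReal_nonneg)
    ((eventually_ge_atTop 1).mono fun n hn => ?_)
    (tendsto_const_div_atTop_nhds_zero_nat (Q * R / ε ^ 2))
  have := hμ n hn
  have := hν n hn
  exact (hμ' n hn).measureReal_inner_ge (hν' n hn) hn hε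

/-- Union bound: the number of conditions depends only on `M` and `L`, and each fails with vanishing
probability. -/
lemma tendsto_measureReal_not_isTypical {K M L : ℕ} (hM : 1 ≤ M) {P Q : ℝ}
    {μ : (n : ℕ) → Measure (Codeword n)} (hμ : IsCodeFamily P Q μ) {ε : ℝ} (hε : 0 < ε) :
    Tendsto (fun n : ℕ => (jointLaw K M L (μ n)).real
      {ω | ¬ IsTypical P Q ε ω.1 ω.2.2.2}) atTop (𝓝 0) := by
  have hcode : ∀ (m : Fin M) (n : ℕ), 1 ≤ n → MeasurePreserving
      (fun ω : Outcome K M L n => ω.1 m) (jointLaw K M L (μ n)) (μ n) := fun m n hn => by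
    have := hμ.isProbabilityMeasure n hn
    exact (measurePreserving_eval (fun _ => μ n) m).comp (measurePreserving_codebook hM)
  have hnoise : ∀ (l : Fin L) (n : ℕ), 1 ≤ n → MeasurePreserving
      (fun ω : Outcome K M L n => noiseColumn ω.2.2.2 l) (jointLaw K M L (μ n))
        (gaussianCodeword 1 n) := fun l n hn => by
    have := hμ.isProbabilityMeasure n hn
    exact (measurePreserving_noiseColumn l).comp (measurePreserving_noise hM)
  have hpair : ∀ (p : {p : Fin M × Fin M // p.1 ≠ p.2}) (n : ℕ), 1 ≤ n → MeasurePreserving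
      (fun ω : Outcome K M L n => (ω.1 p.1.1, ω.1 p.1.2)) (jointLaw K M L (μ n))
        ((μ n).prod (μ n)) := fun p n hn => by
    have := hμ.isProbabilityMeasure n hn
    exact (measurePreserving_pi_pair (μ n) p.2).comp (measurePreserving_codebook hM)
  have hcross : ∀ (p : Fin M × Fin L) (n : ℕ), 1 ≤ n → MeasurePreserving
      (fun ω : Outcome K M L n => (ω.1 p.1, noiseColumn ω.2.2.2 p.2)) (jointLaw K M L (μ n))
        ((μ n).prod (gaussianCodeword 1 n)) := fun p n hn => by
    have := hμ.isProbabilityMeasure n hn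
    exact ((measurePreserving_eval (fun _ => μ n) p.1).prod
      (measurePreserving_noiseColumn p.2)).comp (measurePreserving_codebook_noise hM)
  have h1 := tendsto_measureReal_iUnion fun m => tendsto_measureReal_preimage (hcode m)
    (fun n => measurableSet_lt (by fun_prop) (by fun_prop)) hμ.tendsto_power
  have h2 := tendsto_measureReal_iUnion fun m => tendsto_measureReal_preimage (hcode m)
    (fun n => measurableSet_le (by fun_prop) (by fun_prop)) (hμ.tendsto_norm_sq ε hε)
  have h3 := tendsto_measureReal_iUnion fun p => tendsto_measureReal_preimage (hpair p)
    (fun n => measurableSet_le_norm_inner n _)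
    (tendsto_measureReal_inner hμ.isProbabilityMeasure hμ.isWhite hμ.isProbabilityMeasure
      hμ.isWhite hε)
  have h4 := tendsto_measureReal_iUnion fun l => tendsto_measureReal_preimage (hnoise l)
    (fun n => measurableSet_le (by fun_prop) (by fun_prop))
    (tendsto_gaussianCodeword_norm_sq zero_le_one hε)
  have h5 := tendsto_measureReal_iUnion fun p => tendsto_measureReal_preimage (hcross p)
    (fun n => measurableSet_le_norm_inner n _)
    (tendsto_measureReal_inner hμ.isProbabilityMeasure hμ.isWhite (fun _ _ => inferInstance)
      (fun n _ => isWhite_gaussianCodeword zero_le_one n) hε)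
  have h := tendsto_measureReal_union (tendsto_measureReal_union (tendsto_measureReal_union
    (tendsto_measureReal_union h1 h2) h3) h4) h5
  refine squeeze_zero' (.of_forall fun n => measureReal_nonneg)
    ((eventually_ge_atTop 1).mono fun n hn => ?_) h
  have := hμ.isProbabilityMeasure n hn
  have := isProbabilityMeasure_jointLaw (K := K) (L := L) (μ := μ n) hM
  refine measureReal_mono fun ω hω => ?_
  by_contra hc
  simp only [Set.mem_union, Set.mem_iUnion, Set.mem_preimage, Set.mem_ofPred_eq, not_or,
    not_exists, not_lt, not_le, Subtype.forall, Prod.forall] at hc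
  obtain ⟨⟨⟨⟨hc1, hc2⟩, hc3⟩, hc4⟩, hc5⟩ := hc
  exact hω ⟨hc1, hc2, hc3, hc4, hc5⟩

/-! ### The limit of the error probability -/

lemma exists_measureReal_lt_of_antitone {X : Type*} [MeasurableSpace X] {μ : Measure X}
    [IsFiniteMeasure μ] {s : ℕ → Set X} (hs : ∀ j, MeasurableSet (s j)) (hanti : Antitone s)
    (h : μ (⋂ j, s j) = 0) {δ : ℝ} (hδ : 0 < δ) : ∃ j, μ.real (s j) < δ := by
  have ht := tendsto_measure_iInter_atTop (fun j => (hs j).nullMeasurableSet) hanti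
    ⟨0, measure_ne_top μ _⟩
  rw [h] at ht
  have ht' := (ENNReal.tendsto_toReal ENNReal.zero_ne_top).comp ht
  exact (ht'.eventually (gt_mem_nhds (by simpa using hδ))).exists

lemma exists_measureReal_abs_sub_le_lt {X : Type*} [MeasurableSpace X] {μ : Measure X}
    [IsFiniteMeasure μ] {f : X → ℝ} (hf : Measurable f) {b : ℝ} (hb : μ {x | f x = b} = 0)
    {δ : ℝ} (hδ : 0 < δ) : ∃ η > 0, μ.real {x | |f x - b| ≤ η} < δ := by
  have hanti : Antitone fun j : ℕ => {x | |f x - b| ≤ 1 / ((j : ℝ) + 1)} := fun i j hij x hx => by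
    have hij' : (i : ℝ) + 1 ≤ j + 1 := by simpa using hij
    exact le_trans (show |f x - b| ≤ 1 / ((j : ℝ) + 1) from hx)
      (one_div_le_one_div_of_le (by positivity) hij')
  have hnull : μ (⋂ j : ℕ, {x | |f x - b| ≤ 1 / ((j : ℝ) + 1)}) = 0 := by
    refine measure_mono_null (fun x hx => ?_) hb
    have hx' : ∀ j : ℕ, |f x - b| ≤ 1 / ((j : ℝ) + 1) := by simpa using hx
    have := ge_of_tendsto' tendsto_one_div_add_atTop_nhds_zero_nat hx'
    exact sub_eq_zero.1 (abs_nonpos_iff.1 this)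
  obtain ⟨j, hj⟩ := exists_measureReal_lt_of_antitone
    (fun j => measurableSet_le (by fun_prop) (by fun_prop)) hanti hnull hδ
  exact ⟨_, by positivity, hj⟩

lemma exists_measureReal_le_lt {X : Type*} [MeasurableSpace X] {μ : Measure X}
    [IsFiniteMeasure μ] {f : X → ℝ} (hf : Measurable f) {δ : ℝ} (hδ : 0 < δ) :
    ∃ r > 0, μ.real {x | r ≤ f x} < δ := by
  have hanti : Antitone fun j : ℕ => {x | (j : ℝ) + 1 ≤ f x} := fun i j hij x hx =>
    le_trans (by simpa using hij) (show (j : ℝ) + 1 ≤ f x from hx)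
  have hnull : μ (⋂ j : ℕ, {x | (j : ℝ) + 1 ≤ f x}) = 0 := by
    refine (congrArg μ (Set.eq_empty_of_forall_notMem fun x hx => ?_)).trans measure_empty
    have hx' : ∀ j : ℕ, (j : ℝ) + 1 ≤ f x := by simpa using hx
    obtain ⟨j, hj⟩ := exists_nat_gt (f x)
    linarith [hx' j]
  obtain ⟨j, hj⟩ := exists_measureReal_lt_of_antitone
    (fun j => measurableSet_le (by fun_prop) (by fun_prop)) hanti hnull hδ
  exact ⟨_, by positivity, hj⟩

/-- Off a bad event of probability below `δ`, the estimate is `Kest` exactly when the fading energy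
lies in the cell. The bad event joins four of probability below `δ / 4`: energy near either
boundary, large coefficients, atypical codebook or noise. -/
theorem tendsto_errorProb {K M L : ℕ} (hM : 1 ≤ M) (hL : 1 ≤ L) {P Q : ℝ} (hQ : 0 < Q)
    {A : Finset (Fin K)} (hA : A.Nonempty) {Kest : ℕ} (hKest : 1 ≤ Kest) (hKest' : Kest ≤ K)
    {μ : (n : ℕ) → Measure (Codeword n)} (hμ : IsCodeFamily P Q μ)
    {est : (n : ℕ) → Matrix (Fin n) (Fin L) ℂ → ℕ} (hest : ∀ n, IsEnergyEstimator K Q (est n)) :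
    Tendsto (fun n : ℕ => errorProb M P A (μ n) (est n) Kest) atTop
      (𝓝 (((messageLaw K M).prod (fadingLaw K L)).real
        {x | fadingEnergy A x.1 x.2 ∈ decisionRegion K Kest})) := by
  have := isProbabilityMeasure_uniformOn_fin hM
  let ρ := (messageLaw K M).prod (fadingLaw K L)
  let T : (Fin K → Fin M) × (Fin K → Fin L → ℂ) → ℝ := fun x => fadingEnergy A x.1 x.2
  let S : (Fin K → Fin M) × (Fin K → Fin L → ℂ) → ℝ := fun x => coefficientBound A x.1 x.2
  have hT : Measurable T := measurable_fadingEnergy A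
  have hS : Measurable S := measurable_coefficientBound A
  have hT0 : ∀ t, ρ {x | T x = t} = 0 := messageLaw_prod_fadingLaw_fadingEnergy_eq hA hL
  refine Metric.tendsto_atTop'.2 fun δ hδ => ?_
  obtain ⟨η₁, hη₁, h₁⟩ := exists_measureReal_abs_sub_le_lt hT (hT0 (Kest - 1 / 2))
    (show 0 < δ / 4 by positivity)
  obtain ⟨η₂, hη₂, h₂⟩ := exists_measureReal_abs_sub_le_lt hT (hT0 (Kest + 1 / 2))
    (show 0 < δ / 4 by positivity)
  obtain ⟨r, hr, h₃⟩ := exists_measureReal_le_lt (μ := ρ) hS (show 0 < δ / 4 by positivity)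
  let η := min η₁ η₂
  have hη : 0 < η := lt_min hη₁ hη₂
  -- This tolerance keeps the energy error `ε * S` below `Q * η` as long as `S < r`.
  have hε : 0 < Q * η / r := by positivity
  have h₄ := tendsto_measureReal_not_isTypical (K := K) (L := L) hM hμ hε
  have h₄' := (h₄.eventually (gt_mem_nhds (show 0 < δ / 4 by positivity))).and
    (eventually_ge_atTop 1)
  obtain ⟨N, hN⟩ := eventually_atTop.1 h₄'
  refine ⟨N, fun n hn => ?_⟩
  obtain ⟨hty, hn1⟩ := hN n hn.le
  have := hμ.isProbabilityMeasure n hn1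
  have := isProbabilityMeasure_jointLaw (K := K) (L := L) (μ := μ n) hM
  let J := jointLaw K M L (μ n)
  let π : Outcome K M L n → (Fin K → Fin M) × (Fin K → Fin L → ℂ) := fun ω => (ω.2.1, ω.2.2.1)
  have hπ : MeasurePreserving π J ρ := measurePreserving_message_fading hM
  let E : Set (Outcome K M L n) :=
    {ω | est n (received P A ω.1 ω.2.1 ω.2.2.1 ω.2.2.2) = Kest}
  let R : Set (Outcome K M L n) := π ⁻¹' {x | T x ∈ decisionRegion K Kest}
  let B : Set (Outcome K M L n) := π ⁻¹' {x | |T x - (Kest - 1 / 2)| ≤ η₁} ∪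
    π ⁻¹' {x | |T x - (Kest + 1 / 2)| ≤ η₂} ∪ π ⁻¹' {x | r ≤ S x} ∪
      {ω | ¬ IsTypical P Q (Q * η / r) ω.1 ω.2.2.2}
  have hB : J.real B < δ := by
    refine (measureReal_union_le _ _).trans_lt ?_
    have e₁ := hπ.measureReal_preimage (s := {x | |T x - (Kest - 1 / 2)| ≤ η₁})
      (measurableSet_le (by fun_prop) (by fun_prop)).nullMeasurableSet
    have e₂ := hπ.measureReal_preimage (s := {x | |T x - (Kest + 1 / 2)| ≤ η₂})
      (measurableSet_le (by fun_prop) (by fun_prop)).nullMeasurableSet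
    have e₃ := hπ.measureReal_preimage (s := {x | r ≤ S x})
      (measurableSet_le (by fun_prop) (by fun_prop)).nullMeasurableSet
    have u₁ := measureReal_union_le (μ := J) (π ⁻¹' {x | |T x - (Kest - 1 / 2)| ≤ η₁} ∪
      π ⁻¹' {x | |T x - (Kest + 1 / 2)| ≤ η₂}) (π ⁻¹' {x | r ≤ S x})
    have u₂ := measureReal_union_le (μ := J) (π ⁻¹' {x | |T x - (Kest - 1 / 2)| ≤ η₁})
      (π ⁻¹' {x | |T x - (Kest + 1 / 2)| ≤ η₂})
    linarith
  have hiff : ∀ ω ∉ B, (ω ∈ E ↔ ω ∈ R) := fun ω hω => by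
    simp only [B, Set.mem_union, Set.mem_preimage, Set.mem_ofPred_eq, not_or, not_le,
      not_not] at hω
    obtain ⟨⟨⟨hω₁, hω₂⟩, hω₃⟩, hω₄⟩ := hω
    refine (hest n).eq_iff hQ hKest hKest' (η := η) ?_ ((min_le_left _ _).trans_lt hω₁)
      ((min_le_right _ _).trans_lt hω₂)
    refine (hω₄.abs_energy_sub_le hn1 hL).trans_lt ?_
    rw [div_mul_eq_mul_div, div_lt_iff₀ hr]
    exact mul_lt_mul_of_pos_left hω₃ (by positivity)
  -- `est n` need not be measurable; monotonicity and subadditivity of the outer measure suffice.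
  have hER : J.real E ≤ J.real R + J.real B := (measureReal_mono fun ω hω => by
    by_cases hb : ω ∈ B
    · exact .inr hb
    · exact .inl ((hiff ω hb).1 hω)).trans (measureReal_union_le _ _)
  have hRE : J.real R ≤ J.real E + J.real B := (measureReal_mono fun ω hω => by
    by_cases hb : ω ∈ B
    · exact .inr hb
    · exact .inl ((hiff ω hb).2 hω)).trans (measureReal_union_le _ _)
  have hR : J.real R = ρ.real {x | T x ∈ decisionRegion K Kest} := hπ.measureReal_preimage
    (hT (isOpen_decisionRegion K Kest).measurableSet).nullMeasurableSet
  change |J.real E - ρ.real {x | T x ∈ decisionRegion K Kest}| < δ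
  rw [← hR, abs_lt]
  constructor <;> linarith

theorem exists_tendsto_errorProb {K M L : ℕ} (hM : 1 ≤ M) (hL : 1 ≤ L) {P Q : ℝ} (hQ : 0 < Q)
    {A : Finset (Fin K)} (hA : 1 ≤ A.card) {Kest : ℕ} (hKest : 1 ≤ Kest) (hKest' : Kest ≤ K)
    (hne : Kest ≠ A.card) {μ : (n : ℕ) → Measure (Codeword n)} (hμ : IsCodeFamily P Q μ)
    {est : (n : ℕ) → Matrix (Fin n) (Fin L) ℂ → ℕ} (hest : ∀ n, IsEnergyEstimator K Q (est n)) :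
    ∃ p : ℝ, Tendsto (fun n : ℕ => errorProb M P A (μ n) (est n) Kest) atTop (𝓝 p) ∧
      0 < p ∧ p ≤ errorFloor A.card Kest L + (A.card.choose 2 : ℝ) / M := by
  have := isProbabilityMeasure_uniformOn_fin hM
  have hA' : A.Nonempty := Finset.card_pos.1 hA
  refine ⟨_, tendsto_errorProb hM hL hQ hA' hKest hKest' hμ hest, ?_,
    measureReal_decisionRegion_le hM hL hA hKest' hne⟩
  exact ENNReal.toReal_pos (measure_decisionRegion_pos hM hL hA' Kest).ne' (measure_ne_top _ _)

end URA

theorem corollary3 (K M L : ℕ) (hM : 1 ≤ M) (hL : 1 ≤ L) (P : ℝ)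
    (A : Finset (Fin K)) (Ka : ℕ) (hA : A.card = Ka) (hKa : 1 ≤ Ka)
    (Kest : ℕ) (hKest : 1 ≤ Kest) (hKest' : Kest ≤ K) (hne : Kest ≠ Ka) :
    (∀ Q : ℝ, 0 < Q → Q < P →
      ∀ est : (n : ℕ) → Matrix (Fin n) (Fin L) ℂ → ℕ,
        (∀ n, URA.IsEnergyEstimator K Q (est n)) →
        ∃ p : ℝ,
          Tendsto (fun n : ℕ => URA.errorProb M P A (URA.gaussianCodeword Q n) (est n) Kest)
            atTop (𝓝 p) ∧
          0 < p ∧ p ≤ URA.errorFloor Ka Kest L + (Ka.choose 2 : ℝ) / M) ∧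
    (∀ Q : ℝ, 0 < Q → Q ≤ P →
      ∀ est : (n : ℕ) → Matrix (Fin n) (Fin L) ℂ → ℕ,
        (∀ n, URA.IsEnergyEstimator K Q (est n)) →
        ∃ p : ℝ,
          Tendsto (fun n : ℕ => URA.errorProb M P A (URA.sphericalCodeword Q n) (est n) Kest)
            atTop (𝓝 p) ∧
          0 < p ∧ p ≤ URA.errorFloor Ka Kest L + (Ka.choose 2 : ℝ) / M) := by
  subst hA
  exact ⟨fun Q hQ hQP est hest => URA.exists_tendsto_errorProb hM hL hQ hKa hKest hKest' hne
      (URA.isCodeFamily_gaussianCodeword hQ hQP) hest,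
    fun Q hQ hQP est hest => URA.exists_tendsto_errorProb hM hL hQ hKa hKest hKest' hne
      (URA.isCodeFamily_sphericalCodeword hQ hQP) hest⟩
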